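/- Let $\mathcal H$ be a separable complex Hilbert space (of finite or infinite dimension; inner products are antilinear in the first argument) and let $\mathcal S(\mathcal H)$ be the Hilbert space of Hilbert–Schmidt operators with $(S,T)_{\mathrm{HS}}=\operatorname{Tr}[S^*T]$. Let $\mathcal T_0$ be the space of trace class operators of trace zero and $\mathcal T_0^{sa}$ its self-adjoint part. Let $\tilde\Xi$ (a complex Hilbert space) be the closure of $\mathcal T_0$ in $\mathcal S(\mathcal H)$, and $\Xi$ (a real Hilbert space) the closure of $\mathcal T_0^{sa}$ in $\mathcal S(\mathcal H)$. Fix a density operator $\rho_0$, let $\Theta=\{\theta\in\mathcal T_0^{sa}: \rho_0+\theta>0\}$, where $T>0$ means $\langle x,Tx\rangle>0$ for all $x\neq0$, put $\rho(\theta)=\rho_0+\theta$, and fix $\theta\in\Theta$. *Observables.* $\tilde{\mathcal O}_{\rho}$ is the set of densely defined, possibly unbounded linear operators $A$ on $\mathcal H$ such that $\rho A$ extends to a trace class operator; $\langle A\rangle_\theta=\operatorname{Tr}[\rho(\theta)A]$ denotes the trace of this extension. Put $C_\theta(A,B)=\langle A^*B\rangle_\theta-\overline{\langle A\rangle_\theta}\,\langle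 B\rangle_\theta$, where $A^*B$ has domain $\{x\in\operatorname{dom}B: Bx\in\operatorname{dom}A^*\}$, and $C^{\mathrm S}_\theta(A,B)=\frac12\{C_\theta(A,B)+C_\theta(B,A)\}$. An element $g\in\tilde\Xi$ is the gradient $\nabla_\theta\langle A\rangle_\theta$ if $\langle A\rangle_{\theta'}-\langle A\rangle_\theta-(g,\theta'-\theta)_{\mathrm{HS}}=o(\|\theta'-\theta\|_{\mathrm{HS}})$ as $\theta'\to\theta$ in $\{\theta'\in\Theta: A\in\tilde{\mathcal O}_{\rho(\theta')}\}$. *Quantum Fisher information operators.* Write $\rho=\rho(\theta)$. For a bounded operator $X$ put $\mathbf K^{\mathrm R}X=\rho X$ and $\mathbf K^{\mathrm S}X=\frac12(\rho X+X\rho)$; a logarithmic derivative of $\varphi$ is a bounded $L(\varphi)$ with $\mathbf K L(\varphi)=\varphi$. The (possibly unbounded) operator $J^{\mathrm R}_\theta$ on $\tilde\Xi$ is defined by: $J^{\mathrm R}_\theta\chi=\psi$ iff $\chi\in\mathcal T_0$ has a logarithmic derivative with respect to $\mathbf K^{\mathrm R}$ and $(\varphi,\psi)_{\mathrm{HS}}=\operatorname{Tr}[(\mathbf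 K^{\mathrm R} L(\varphi))^*L(\chi)]$ for all $\varphi\in\mathcal T_0$ having one. The operator $J^{\mathrm S}_\theta$ on $\Xi$ is defined in the same way with $\mathbf K^{\mathrm S}$ and $\mathcal T_0^{sa}$. *Moore–Penrose inverse.* For an operator $J$ with domain in a Hilbert space, $J^+y=x$ means $x\in\operatorname{dom}J\cap(\ker J)^\perp$ and $y-Jx\in(\operatorname{ran}J)^\perp$. *Measurement.* Let $M$ be a POVM on a measurable space $(\Omega,\mathfrak B)$ and $P^M_\theta(B)=\operatorname{Tr}[\rho(\theta)M(B)]$. For $\varphi\in\mathcal T_0^{sa}$ let $l_\theta(\varphi)$ be the Radon–Nikodym derivative of $B\mapsto\operatorname{Tr}[\varphi M(B)]$ with respect to $P^M_\theta$. The classical Fisher information operator $J^M_\theta$ on $\Xi$ is defined by: $J^M_\theta\varphi=\psi$ iff $\varphi\in\mathcal T_0^{sa}$, $l_\theta(\varphi)\in L^2(P^M_\theta)$ and $(\chi,\psi)_\Xi=\mathbb E_\theta[l_\theta(\chi)l_\theta(\varphi)]$ for all $\chi\in\mathcal T_0^{sa}$ with $l_\theta(\chi)\in L^2(P^M_\theta)$.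 Here $(\ker J^M_\theta)^\perp$ is the orthogonal complement of its kernel, extended complex linearly, in $\tilde\Xi$. **Theorem.** Let $A,B\in\tilde{\mathcal O}_{\rho(\theta)}$ with $A^*B\in\tilde{\mathcal O}_{\rho(\theta)}$, and suppose that the gradients $\nabla_\theta\langle A\rangle_\theta,\nabla_\theta\langle B\rangle_\theta\in\tilde\Xi$ exist and lie in $(\ker J^M_\theta)^\perp$. Then $\nabla_\theta\langle A\rangle_\theta\in\operatorname{dom}(J^{\mathrm R}_\theta)^+$ and $$C_\theta(A,B)=\left(\nabla_\theta\langle B\rangle_\theta,(J^{\mathrm R}_\theta)^+\nabla_\theta\langle A\rangle_\theta\right)_{\tilde\Xi}.$$ If, in addition, $A$ and $B$ are self-adjoint, then both gradients lie in $\Xi$, $\nabla_\theta\langle A\rangle_\theta\in\operatorname{dom}(J^{\mathrm S}_\theta)^+$ and $$C^{\mathrm S}_\theta(A,B)=\left(\nabla_\theta\langle B\rangle_\theta,(J^{\mathrm S}_\theta)^+\nabla_\theta\langle A\rangle_\theta\right)_{\Xi}.$$ -/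

import Mathlib

open scoped InnerProductSpace ENNReal Topology

noncomputable section

namespace QEst

/-! ### Trace class operators, the trace, Hilbert-Schmidt operators -/

section Operators

/-- Index set of a fixed orthonormal (Hilbert) basis of `H`. -/
def basisIndex (H : Type*) [NormedAddCommGroup H] [InnerProductSpace ℂ H] [CompleteSpace H] :
    Set H := (exists_hilbertBasis ℂ H).choose

/-- A fixed orthonormal (Hilbert) basis of `H`. -/
def onb (H : Type*) [NormedAddCommGroup H] [InnerProductSpace ℂ H] [CompleteSpace H] :
    HilbertBasis (basisIndex H) ℂ H := (exists_hilbertBasis ℂ H).choose_spec.choose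

variable {H : Type*} [NormedAddCommGroup H] [InnerProductSpace ℂ H] [CompleteSpace H]

set_option linter.unusedSectionVars false

/-- Trace class operators, as the nuclear operators of the Hilbert space `H`:
`T = ∑ₙ ⟨xₙ, ·⟩ yₙ` with `∑ₙ ‖xₙ‖ ‖yₙ‖ < ∞`. These are exactly the bounded operators with
`Tr √(T* T) < ∞`. -/
def IsTraceClass (T : H →L[ℂ] H) : Prop :=
  ∃ x y : ℕ → H, Summable (fun n => ‖x n‖ * ‖y n‖) ∧
    ∀ z, HasSum (fun n => ⟪x n, z⟫_ℂ • y n) (T z)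

/-- The trace `Tr T = ∑ᵢ ⟨eᵢ, T eᵢ⟩`. -/
def opTrace (T : H →L[ℂ] H) : ℂ := ∑' i, ⟪onb H i, T (onb H i)⟫_ℂ

lemma summable_sq_onb (x : H) : Summable (fun i => ‖⟪onb H i, x⟫_ℂ‖ ^ 2) :=
  (onb H).orthonormal.inner_products_summable x

lemma summable_mul_onb (x y : H) :
    Summable (fun i => ‖⟪x, onb H i⟫_ℂ‖ * ‖⟪onb H i, y⟫_ℂ‖) ∧
      ∑' i, ‖⟪x, onb H i⟫_ℂ‖ * ‖⟪onb H i, y⟫_ℂ‖ ≤ ‖x‖ * ‖y‖ := by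
  have hx := summable_sq_onb (H := H) x
  have hy := summable_sq_onb (H := H) y
  have hxl := (onb H).orthonormal.tsum_inner_products_le (𝕜 := ℂ) x
  have hyl := (onb H).orthonormal.tsum_inner_products_le (𝕜 := ℂ) y
  have key := Real.inner_le_Lp_mul_Lq_tsum_of_nonneg (p := 2) (q := 2)
    (f := fun i => ‖⟪onb H i, x⟫_ℂ‖) (g := fun i => ‖⟪onb H i, y⟫_ℂ‖)
    Real.HolderConjugate.two_two (fun i => norm_nonneg _) (fun i => norm_nonneg _)
    (by simpa using hx) (by simpa using hy)
  have key' := Real.summable_mul_of_Lp_Lq_of_nonneg (p := 2) (q := 2)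
    (f := fun i => ‖⟪onb H i, x⟫_ℂ‖) (g := fun i => ‖⟪onb H i, y⟫_ℂ‖)
    Real.HolderConjugate.two_two (fun i => norm_nonneg _) (fun i => norm_nonneg _)
    (by simpa using hx) (by simpa using hy)
  have e : ∀ i, ‖⟪x, onb H i⟫_ℂ‖ = ‖⟪onb H i, x⟫_ℂ‖ := fun i => norm_inner_symm _ _
  simp only [e]
  refine ⟨key', key.trans ?_⟩
  gcongr
  · rw [← Real.sqrt_eq_rpow]
    exact Real.sqrt_le_iff.2 ⟨norm_nonneg _, by simpa using hxl⟩
  · rw [← Real.sqrt_eq_rpow]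
    exact Real.sqrt_le_iff.2 ⟨norm_nonneg _, by simpa using hyl⟩

/-- The trace series of a trace class operator converges, to `∑ₙ ⟨xₙ, yₙ⟩`. -/
lemma hasSum_diag {T : H →L[ℂ] H} {x y : ℕ → H} (hs : Summable (fun n => ‖x n‖ * ‖y n‖))
    (hT : ∀ z, HasSum (fun n => ⟪x n, z⟫_ℂ • y n) (T z)) :
    HasSum (fun i => ⟪onb H i, T (onb H i)⟫_ℂ) (∑' n, ⟪x n, y n⟫_ℂ) := by
  let f : ℕ × basisIndex H → ℂ := fun p => ⟪x p.1, onb H p.2⟫_ℂ * ⟪onb H p.2, y p.1⟫_ℂ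
  have hf : Summable f := by
    apply Summable.of_norm
    refine (summable_prod_of_nonneg (fun p => norm_nonneg _)).2 ⟨fun n => ?_, ?_⟩
    · simpa [f] using (summable_mul_onb (x n) (y n)).1
    · refine Summable.of_nonneg_of_le (fun n => tsum_nonneg fun i => norm_nonneg _)
        (fun n => ?_) hs
      simpa [f] using (summable_mul_onb (x n) (y n)).2
  have h1 : HasSum (fun n => ⟪x n, y n⟫_ℂ) (∑' p, f p) :=
    hf.hasSum.prod_fiberwise (fun n => (onb H).hasSum_inner_mul_inner (x n) (y n))
  have h2 : HasSum (fun i => ⟪onb H i, T (onb H i)⟫_ℂ) (∑' p, f p) := by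
    have hsw : HasSum (fun p : basisIndex H × ℕ => f p.swap) (∑' p, f p) :=
      (Equiv.prodComm _ _).hasSum_iff.2 hf.hasSum
    refine hsw.prod_fiberwise (fun i => ?_)
    have := (hT (onb H i)).mapL (innerSL ℂ (onb H i))
    simpa [f, inner_smul_right] using this
  rwa [h1.tsum_eq]

lemma IsTraceClass.summable_diag {T : H →L[ℂ] H} (h : IsTraceClass T) :
    Summable (fun i => ⟪onb H i, T (onb H i)⟫_ℂ) := by
  obtain ⟨x, y, hs, hT⟩ := h
  exact (hasSum_diag hs hT).summable

lemma isTraceClass_zero : IsTraceClass (0 : H →L[ℂ] H) :=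
  ⟨0, 0, by simp, fun z => by simp⟩

lemma IsTraceClass.add {S T : H →L[ℂ] H} (hS : IsTraceClass S) (hT : IsTraceClass T) :
    IsTraceClass (S + T) := by
  obtain ⟨x, y, h1, h2⟩ := hS
  obtain ⟨u, v, h3, h4⟩ := hT
  obtain ⟨e⟩ : Nonempty (ℕ ≃ ℕ ⊕ ℕ) := ⟨Equiv.natSumNatEquivNat.symm⟩
  refine ⟨Sum.elim x u ∘ e, Sum.elim y v ∘ e, ?_, fun z => ?_⟩
  · have : Summable (fun s : ℕ ⊕ ℕ => ‖Sum.elim x u s‖ * ‖Sum.elim y v s‖) :=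
      (HasSum.sum (f := fun s : ℕ ⊕ ℕ => ‖Sum.elim x u s‖ * ‖Sum.elim y v s‖)
        h1.hasSum h3.hasSum).summable
    exact e.summable_iff.2 this
  · have : HasSum (fun s : ℕ ⊕ ℕ => ⟪Sum.elim x u s, z⟫_ℂ • Sum.elim y v s) (S z + T z) :=
      HasSum.sum (f := fun s : ℕ ⊕ ℕ => ⟪Sum.elim x u s, z⟫_ℂ • Sum.elim y v s) (h2 z) (h4 z)
    exact e.hasSum_iff.2 this

/-- Trace class operators form a two-sided ideal. -/
lemma IsTraceClass.mul {T : H →L[ℂ] H} (hT : IsTraceClass T) (S R : H →L[ℂ] H) :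
    IsTraceClass (S * T * R) := by
  obtain ⟨x, y, h1, h2⟩ := hT
  refine ⟨fun n => star R (x n), fun n => S (y n), ?_, fun z => ?_⟩
  · refine Summable.of_nonneg_of_le (fun n => by positivity) (fun n => ?_)
      (h1.mul_left (‖star R‖ * ‖S‖))
    calc ‖star R (x n)‖ * ‖S (y n)‖ ≤ (‖star R‖ * ‖x n‖) * (‖S‖ * ‖y n‖) := by
          gcongr <;> exact ContinuousLinearMap.le_opNorm _ _
      _ = _ := by ring
  · have := (h2 (R z)).mapL S
    simpa [ContinuousLinearMap.star_eq_adjoint, ContinuousLinearMap.adjoint_inner_left] using this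

lemma IsTraceClass.mul_left {T : H →L[ℂ] H} (hT : IsTraceClass T) (S : H →L[ℂ] H) :
    IsTraceClass (S * T) := by simpa using hT.mul S 1

lemma IsTraceClass.mul_right {T : H →L[ℂ] H} (hT : IsTraceClass T) (R : H →L[ℂ] H) :
    IsTraceClass (T * R) := by simpa using hT.mul 1 R

lemma IsTraceClass.smul {T : H →L[ℂ] H} (hT : IsTraceClass T) (c : ℂ) :
    IsTraceClass (c • T) := by simpa using hT.mul_left (c • 1)

lemma IsTraceClass.star {T : H →L[ℂ] H} (hT : IsTraceClass T) : IsTraceClass (star T) := by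
  obtain ⟨x, y, h1, h2⟩ := hT
  have hsum : ∀ z, Summable (fun n => ⟪y n, z⟫_ℂ • x n) := fun z => by
    apply Summable.of_norm
    refine Summable.of_nonneg_of_le (fun n => norm_nonneg _) (fun n => ?_) (h1.mul_right ‖z‖)
    rw [norm_smul]
    calc ‖⟪y n, z⟫_ℂ‖ * ‖x n‖ ≤ (‖y n‖ * ‖z‖) * ‖x n‖ := by
          gcongr; exact norm_inner_le_norm _ _
      _ = _ := by ring
  refine ⟨y, x, by simpa [mul_comm] using h1, fun z => ?_⟩
  convert (hsum z).hasSum using 1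
  refine ext_inner_left ℂ fun w => ?_
  have e1 : HasSum (fun n => ⟪w, ⟪y n, z⟫_ℂ • x n⟫_ℂ) ⟪w, ∑' n, ⟪y n, z⟫_ℂ • x n⟫_ℂ :=
    (hsum z).hasSum.mapL (innerSL ℂ w)
  have e2 : HasSum (fun n => ⟪z, ⟪x n, w⟫_ℂ • y n⟫_ℂ) ⟪z, T w⟫_ℂ := (h2 w).mapL (innerSL ℂ z)
  have e3 := (Complex.hasSum_conj' (f := fun n => ⟪z, ⟪x n, w⟫_ℂ • y n⟫_ℂ)).2
    (by simpa using e2)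
  rw [ContinuousLinearMap.star_eq_adjoint, ContinuousLinearMap.adjoint_inner_right]
  have e4 : HasSum (fun n => ⟪w, ⟪y n, z⟫_ℂ • x n⟫_ℂ) ⟪T w, z⟫_ℂ := by
    convert (Complex.hasSum_conj (f := fun n => ⟪z, ⟪x n, w⟫_ℂ • y n⟫_ℂ)
      (x := ⟪T w, z⟫_ℂ)).2 (by simpa using e2) using 2 with n
    simp [mul_comm]
  exact e4.unique e1

lemma opTrace_add {S T : H →L[ℂ] H} (hS : IsTraceClass S) (hT : IsTraceClass T) :
    opTrace (S + T) = opTrace S + opTrace T := by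
  simp only [opTrace, add_apply, inner_add_right]
  exact hS.summable_diag.tsum_add hT.summable_diag

lemma opTrace_smul (c : ℂ) (T : H →L[ℂ] H) : opTrace (c • T) = c * opTrace T := by
  simp only [opTrace, smul_apply, inner_smul_right]
  exact tsum_mul_left

lemma opTrace_zero : opTrace (0 : H →L[ℂ] H) = 0 := by simp [opTrace]


/-- Hilbert-Schmidt operators: `∑ᵢ ‖T eᵢ‖² < ∞`. -/
def hsSubmodule (H : Type*) [NormedAddCommGroup H] [InnerProductSpace ℂ H] [CompleteSpace H] :
    Submodule ℂ (H →L[ℂ] H) where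
  carrier := {T | Summable (fun i => ‖T (onb H i)‖ ^ 2)}
  zero_mem' := by simp
  add_mem' := by
    intro S T hS hT
    refine Summable.of_nonneg_of_le (fun i => by positivity) (fun i => ?_)
      ((hS.add hT).mul_left 2)
    have h := norm_add_le (S (onb H i)) (T (onb H i))
    have h0 := norm_nonneg (S (onb H i) + T (onb H i))
    simp only [add_apply]
    nlinarith [sq_nonneg (‖S (onb H i)‖ - ‖T (onb H i)‖)]
  smul_mem' := by
    intro c T hT
    have : Summable (fun i => ‖c‖ ^ 2 * ‖T (onb H i)‖ ^ 2) := hT.mul_left _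
    simpa [norm_smul, mul_pow] using this

/-- The space `S(H)` of Hilbert-Schmidt operators on `H`. -/
def HS (H : Type*) [NormedAddCommGroup H] [InnerProductSpace ℂ H] [CompleteSpace H] : Type _ :=
  hsSubmodule H

instance : AddCommGroup (HS H) := inferInstanceAs (AddCommGroup (hsSubmodule H))
instance instModuleHS : Module ℂ (HS H) := inferInstanceAs (Module ℂ (hsSubmodule H))

/-- The bounded operator underlying a Hilbert-Schmidt operator. -/
def HS.op : HS H →ₗ[ℂ] (H →L[ℂ] H) := (hsSubmodule H).subtype

lemma HS.op_injective : Function.Injective (HS.op : HS H → (H →L[ℂ] H)) :=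
  Subtype.val_injective

lemma HS.memℓp (T : HS H) : Memℓp (E := fun _ : basisIndex H => H) (fun i => T.op (onb H i)) 2 :=
  (memℓp_gen_iff (by simp)).2 (by
    have h : Summable (fun i => ‖T.op (onb H i)‖ ^ 2) := T.2
    simpa using h)

/-- A Hilbert-Schmidt operator as the square summable family `(T eᵢ)ᵢ`. -/
def HS.toLp : HS H →ₗ[ℂ] lp (fun _ : basisIndex H => H) 2 where
  toFun T := ⟨fun i => T.op (onb H i), T.memℓp⟩
  map_add' S T := by ext i; simp; rfl
  map_smul' c T := by ext i; simp

lemma HS.toLp_injective : Function.Injective (HS.toLp : HS H → _) := by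
  intro S T h
  apply HS.op_injective
  have h' : ∀ i, S.op (onb H i) = T.op (onb H i) := fun i =>
    congrFun (congrArg Subtype.val h) i
  refine ContinuousLinearMap.ext_on (s := Set.range (onb H)) ?_ ?_
  · have := (onb H).dense_span
    rw [Submodule.dense_iff_topologicalClosure_eq_top]
    exact this
  · rintro _ ⟨i, rfl⟩
    exact h' i

/-- The Hilbert-Schmidt inner product `(S, T)_HS = Tr[S* T] = ∑ᵢ ⟨S eᵢ, T eᵢ⟩`. -/
abbrev HS.core : InnerProductSpace.Core ℂ (HS H) where
  inner S T := ∑' i, ⟪S.op (onb H i), T.op (onb H i)⟫_ℂ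
  conj_inner_symm S T := by
    have h := inner_conj_symm (𝕜 := ℂ) S.toLp T.toLp
    rw [lp.inner_eq_tsum, lp.inner_eq_tsum] at h
    exact h
  re_inner_nonneg S := by
    have h := inner_self_nonneg (𝕜 := ℂ) (x := S.toLp)
    rw [lp.inner_eq_tsum] at h
    exact h
  add_left R S T := by
    have h := inner_add_left (𝕜 := ℂ) R.toLp S.toLp T.toLp
    rw [← map_add, lp.inner_eq_tsum, lp.inner_eq_tsum, lp.inner_eq_tsum] at h
    exact h
  smul_left S T c := by
    have h := inner_smul_left (𝕜 := ℂ) S.toLp T.toLp c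
    rw [← map_smul, lp.inner_eq_tsum, lp.inner_eq_tsum] at h
    exact h
  definite S h := by
    apply HS.toLp_injective
    rw [map_zero, ← inner_self_eq_zero (𝕜 := ℂ), lp.inner_eq_tsum]
    exact h

instance : NormedAddCommGroup (HS H) := HS.core.toNormedAddCommGroup
instance : InnerProductSpace ℂ (HS H) := InnerProductSpace.ofCore HS.core.toCore
/-- The underlying real inner product `Re (S, T)_HS`. -/
instance : InnerProductSpace ℝ (HS H) := InnerProductSpace.complexToReal

/-! ### The parameter spaces -/

/-- `T₀(H)`: the trace class operators with trace zero. -/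
def T0 (H : Type*) [NormedAddCommGroup H] [InnerProductSpace ℂ H] [CompleteSpace H] :
    Submodule ℂ (HS H) where
  carrier := {T | IsTraceClass T.op ∧ opTrace T.op = 0}
  zero_mem' := by
    refine ⟨?_, ?_⟩ <;> rw [map_zero]
    exacts [isTraceClass_zero, opTrace_zero]
  add_mem' := by
    rintro S T ⟨h1, h2⟩ ⟨h3, h4⟩
    refine ⟨?_, ?_⟩ <;> rw [map_add]
    exacts [h1.add h3, by rw [opTrace_add h1 h3, h2, h4, add_zero]]
  smul_mem' := by
    rintro c T ⟨h1, h2⟩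
    refine ⟨?_, ?_⟩ <;> rw [map_smul]
    exacts [h1.smul c, by rw [opTrace_smul, h2, mul_zero]]

/-- The self-adjoint trace class operators with trace zero. -/
def T0sa (H : Type*) [NormedAddCommGroup H] [InnerProductSpace ℂ H] [CompleteSpace H] :
    Submodule ℝ (HS H) where
  carrier := {T | T ∈ T0 H ∧ IsSelfAdjoint T.op}
  zero_mem' := ⟨zero_mem _, by rw [map_zero]; exact .zero _⟩
  add_mem' := by
    rintro S T ⟨h1, h2⟩ ⟨h3, h4⟩
    exact ⟨add_mem h1 h3, by rw [map_add]; exact h2.add h4⟩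
  smul_mem' := by
    rintro c T ⟨h1, h2⟩
    have e : c • T = (c : ℂ) • T := rfl
    refine ⟨by rw [e]; exact (T0 H).smul_mem _ h1, ?_⟩
    rw [e, map_smul]
    exact IsSelfAdjoint.smul (by simp [IsSelfAdjoint]) h2

/-- The complex Hilbert space `Ξ̃`: the closure of `T₀(H)` in the Hilbert space of
Hilbert-Schmidt operators. -/
def XiC (H : Type*) [NormedAddCommGroup H] [InnerProductSpace ℂ H] [CompleteSpace H] :
    Submodule ℂ (HS H) := (T0 H).topologicalClosure

/-- The real Hilbert space `Ξ`: the closure of the self-adjoint part of `T₀(H)` in the Hilbert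
space of Hilbert-Schmidt operators. -/
def XiR (H : Type*) [NormedAddCommGroup H] [InnerProductSpace ℂ H] [CompleteSpace H] :
    Submodule ℝ (HS H) := (T0sa H).topologicalClosure

/-! ### States -/

/-- Density operators: positive, trace class, of trace one. -/
structure DensityOperator (H : Type*) [NormedAddCommGroup H] [InnerProductSpace ℂ H]
    [CompleteSpace H] where
  op : H →L[ℂ] H
  isPositive : op.IsPositive
  isTraceClass : IsTraceClass op
  opTrace_eq_one : opTrace op = 1

/-- Strict positivity `T > 0` of a bounded operator: positive, and `⟨x, T x⟩ > 0` for `x ≠ 0`. -/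
def IsStrictlyPos (T : H →L[ℂ] H) : Prop :=
  T.IsPositive ∧ ∀ x, x ≠ 0 → 0 < (⟪x, T x⟫_ℂ).re

/-- The parameter set `Θ = {θ | ρ₀ + θ > 0}`, `θ` ranging over the self-adjoint trace class
operators of trace zero. -/
def paramSet (ρ₀ : DensityOperator H) : Set (HS H) :=
  {θ | θ ∈ T0sa H ∧ IsStrictlyPos (ρ₀.op + θ.op)}

/-- The state `ρ(θ) = ρ₀ + θ`. -/
def stateAt (ρ₀ : DensityOperator H) (θ : paramSet ρ₀) : DensityOperator H where
  op := ρ₀.op + θ.1.op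
  isPositive := θ.2.2.1
  isTraceClass := ρ₀.isTraceClass.add θ.2.1.1.1
  opTrace_eq_one := by
    rw [opTrace_add ρ₀.isTraceClass θ.2.1.1.1, ρ₀.opTrace_eq_one, θ.2.1.1.2, add_zero]

/-! ### Observables, expectations, covariances

Observables are linear operators, possibly unbounded and not everywhere defined. -/

/-- `T` is the trace class operator `ρ A`: the bounded extension of `x ↦ ρ (A x)`,
`x ∈ dom A`. -/
def IsTraceClassProd (ρ : H →L[ℂ] H) (A : H →ₗ.[ℂ] H) (T : H →L[ℂ] H) : Prop :=
  IsTraceClass T ∧ ∀ x : A.domain, T x = ρ (A x)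

/-- The (densely defined) linear operators `A` with `ρ A` trace class. -/
def finiteExp (ρ : H →L[ℂ] H) : Set (H →ₗ.[ℂ] H) :=
  {A | Dense (A.domain : Set H) ∧ ∃ T, IsTraceClassProd ρ A T}

open Classical in
/-- The expectation value `⟨A⟩ = Tr[ρ A]` of `A` in `finiteExp ρ`. -/
def expect (ρ : H →L[ℂ] H) (A : H →ₗ.[ℂ] H) : ℂ :=
  if h : ∃ T, IsTraceClassProd ρ A T then opTrace h.choose else 0

/-- The product `A B` of unbounded operators, with domain `{x ∈ dom B | B x ∈ dom A}`. -/
def pmul (A B : H →ₗ.[ℂ] H) : H →ₗ.[ℂ] H :=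
  A.comp (B.domRestrict ((A.domain.comap B.toFun).map B.domain.subtype)) (by
    rintro ⟨x, ⟨⟨y, hy, rfl⟩, hx⟩⟩
    exact hy)

/-- The correlation `C(A, B) = ⟨A* B⟩ - conj ⟨A⟩ ⟨B⟩`. -/
def cov (ρ : H →L[ℂ] H) (A B : H →ₗ.[ℂ] H) : ℂ :=
  expect ρ (pmul A.adjoint B) - (starRingEnd ℂ) (expect ρ A) * expect ρ B

/-- The symmetrized correlation `(C(A, B) + C(B, A)) / 2`. -/
def symCov (ρ : H →L[ℂ] H) (A B : H →ₗ.[ℂ] H) : ℂ := (cov ρ A B + cov ρ B A) / 2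

/-- `g` is the gradient at `θ` of `θ' ↦ ⟨A⟩_{θ'}`, a function on those `θ'` in `Θ` where the
expectation is finite: its Fréchet derivative at `θ` is `φ ↦ (g, φ)`. -/
def IsGradient (ρ₀ : DensityOperator H) (θ : paramSet ρ₀) (A : H →ₗ.[ℂ] H) (g : XiC H) : Prop :=
  (fun θ' : HS H => expect (ρ₀.op + θ'.op) A - expect (ρ₀.op + θ.1.op) A
      - ⟪(g : HS H), θ' - θ.1⟫_ℂ)
    =o[𝓝[{θ' | θ' ∈ paramSet ρ₀ ∧ A ∈ finiteExp (ρ₀.op + θ'.op)}] θ.1]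
    (fun θ' : HS H => θ' - θ.1)

end Operators

/-! ### Moore-Penrose inverse -/

section MoorePenrose

variable {𝕜 E : Type*} [RCLike 𝕜] [NormedAddCommGroup E] [InnerProductSpace 𝕜 E]

/-- The kernel of a partially defined operator. -/
def pker (J : E →ₗ.[𝕜] E) : Submodule 𝕜 E := (LinearMap.ker J.toFun).map J.domain.subtype

/-- The graph of the Moore-Penrose inverse of a (possibly unbounded) operator `J`: the pairs
`(y, x)` with `x ∈ dom J ∩ (ker J)ᗮ` and `J x` the component of `y` along `ran J`, that is,
`y - J x ∈ (ran J)ᗮ`. -/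
def moorePenroseGraph (J : E →ₗ.[𝕜] E) : Submodule 𝕜 (E × E) where
  carrier := {p | ∃ h : p.2 ∈ J.domain, p.2 ∈ (pker J)ᗮ ∧
    p.1 - J ⟨p.2, h⟩ ∈ (LinearMap.range J.toFun)ᗮ}
  zero_mem' := by
    refine ⟨J.domain.zero_mem, Submodule.zero_mem _, ?_⟩
    have : J ⟨(0 : E × E).2, J.domain.zero_mem⟩ = 0 := J.map_zero
    rw [this]
    simp
  add_mem' := by
    rintro ⟨y, x⟩ ⟨y', x'⟩ ⟨h, h1, h2⟩ ⟨h', h1', h2'⟩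
    refine ⟨J.domain.add_mem h h', Submodule.add_mem _ h1 h1', ?_⟩
    have e : J ⟨x + x', J.domain.add_mem h h'⟩ = J ⟨x, h⟩ + J ⟨x', h'⟩ :=
      J.map_add ⟨x, h⟩ ⟨x', h'⟩
    have := Submodule.add_mem _ h2 h2'
    convert this using 1
    change y + y' - J ⟨x + x', _⟩ = _
    rw [e]
    abel
  smul_mem' := by
    rintro c ⟨y, x⟩ ⟨h, h1, h2⟩
    refine ⟨J.domain.smul_mem c h, Submodule.smul_mem _ c h1, ?_⟩
    have e : J ⟨c • x, J.domain.smul_mem c h⟩ = c • J ⟨x, h⟩ := J.map_smul c ⟨x, h⟩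
    have := Submodule.smul_mem _ c h2
    convert this using 1
    change c • y - J ⟨c • x, _⟩ = _
    rw [e, smul_sub]

/-- The Moore-Penrose graph is single-valued. -/
lemma moorePenroseGraph_functional (J : E →ₗ.[𝕜] E) (p : E × E) (hp : p ∈ moorePenroseGraph J)
    (h0 : p.1 = 0) : p.2 = 0 := by
  obtain ⟨h, h1, h2⟩ := hp
  have hJ : J ⟨p.2, h⟩ = 0 := by
    rw [h0, zero_sub] at h2
    have := (Submodule.mem_orthogonal _ _).1 h2 (J ⟨p.2, h⟩) ⟨⟨p.2, h⟩, rfl⟩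
    rw [inner_neg_right, neg_eq_zero] at this
    exact inner_self_eq_zero.1 this
  have hk : p.2 ∈ pker J := ⟨⟨p.2, h⟩, hJ, rfl⟩
  exact inner_self_eq_zero.1 ((Submodule.mem_orthogonal _ _).1 h1 _ hk)

/-- The Moore-Penrose inverse `J⁺` of a possibly unbounded operator `J`, defined on
`ran J ⊕ (ran J)ᗮ`. -/
def moorePenrose (J : E →ₗ.[𝕜] E) : E →ₗ.[𝕜] E := (moorePenroseGraph J).toLinearPMap

end MoorePenrose

/-! ### Quantum Fisher information operators -/

section QuantumFisher

variable {H : Type*} [NormedAddCommGroup H] [InnerProductSpace ℂ H] [CompleteSpace H]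

/-- `K_ρ^f` for `f(x) = x` (right logarithmic derivative): `X ↦ ρ X`. -/
def KR (ρ : H →L[ℂ] H) : (H →L[ℂ] H) →ₗ[ℂ] (H →L[ℂ] H) := LinearMap.mulLeft ℂ ρ

/-- `K_ρ^f` for `f(x) = (x + 1) / 2` (symmetric logarithmic derivative):
`X ↦ (ρ X + X ρ) / 2`. -/
def KS (ρ : H →L[ℂ] H) : (H →L[ℂ] H) →ₗ[ℂ] (H →L[ℂ] H) :=
  (1 / 2 : ℂ) • (LinearMap.mulLeft ℂ ρ + LinearMap.mulRight ℂ ρ)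

/-- `L` is the logarithmic derivative `K⁻¹ (D_θ ρ[φ])` in the direction `φ`; for the model
`ρ(θ) = ρ₀ + θ` one has `D_θ ρ[φ] = φ`. -/
def IsQLogDeriv (K : (H →L[ℂ] H) →ₗ[ℂ] (H →L[ℂ] H)) (φ : HS H) (L : H →L[ℂ] H) : Prop :=
  K L = φ.op

/-- The graph of the Fisher information operator on `Ξ̃` determined by `K`: `J χ = ψ` iff
`(φ, ψ) = H(φ, χ) = (K L(φ), L(χ))_HS = Tr[(K L(φ))* L(χ)]` for all directions `φ` in `T₀(H)`
that have a logarithmic derivative. -/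
def fisherGraphC (K : (H →L[ℂ] H) →ₗ[ℂ] (H →L[ℂ] H)) : Submodule ℂ (XiC H × XiC H) where
  carrier := {p | (p.1 : HS H) ∈ T0 H ∧ ∃ L, IsQLogDeriv K p.1 L ∧
    ∀ φ ∈ T0 H, ∀ X, IsQLogDeriv K φ X → ⟪φ, (p.2 : HS H)⟫_ℂ = opTrace (star (K X) * L)}
  zero_mem' := by
    refine ⟨zero_mem _, 0, by simp [IsQLogDeriv], fun φ _ X _ => by simp [opTrace_zero]⟩
  add_mem' := by
    rintro p q ⟨h1, L, hL, h2⟩ ⟨h1', L', hL', h2'⟩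
    refine ⟨add_mem h1 h1', L + L', ?_, fun φ hφ X hX => ?_⟩
    · simp only [IsQLogDeriv] at hL hL' ⊢
      simp [hL, hL']
    · have ht : IsTraceClass (star (K X)) := by
        rw [show K X = φ.op from hX]; exact hφ.1.star
      have e : ⟪φ, ((p + q).2 : HS H)⟫_ℂ = ⟪φ, (p.2 : HS H)⟫_ℂ + ⟪φ, (q.2 : HS H)⟫_ℂ := by
        simp
      rw [e, h2 φ hφ X hX, h2' φ hφ X hX, mul_add,
        opTrace_add (ht.mul_right _) (ht.mul_right _)]
  smul_mem' := by
    rintro c p ⟨h1, L, hL, h2⟩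
    refine ⟨(T0 H).smul_mem c h1, c • L, ?_, fun φ hφ X hX => ?_⟩
    · simp only [IsQLogDeriv] at hL ⊢
      simp [hL]
    · have e : ⟪φ, ((c • p).2 : HS H)⟫_ℂ = c * ⟪φ, (p.2 : HS H)⟫_ℂ := by
        simp
      rw [e, h2 φ hφ X hX, mul_smul_comm, opTrace_smul]

/-- The same on the real Hilbert space `Ξ`, with self-adjoint directions. -/
def fisherGraphR (K : (H →L[ℂ] H) →ₗ[ℂ] (H →L[ℂ] H)) : Submodule ℝ (XiR H × XiR H) where
  carrier := {p | (p.1 : HS H) ∈ T0sa H ∧ ∃ L, IsQLogDeriv K p.1 L ∧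
    ∀ φ ∈ T0sa H, ∀ X, IsQLogDeriv K φ X → ⟪φ, (p.2 : HS H)⟫_ℂ = opTrace (star (K X) * L)}
  zero_mem' := by
    refine ⟨zero_mem _, 0, by simp [IsQLogDeriv], fun φ _ X _ => by simp [opTrace_zero]⟩
  add_mem' := by
    rintro p q ⟨h1, L, hL, h2⟩ ⟨h1', L', hL', h2'⟩
    refine ⟨add_mem h1 h1', L + L', ?_, fun φ hφ X hX => ?_⟩
    · simp only [IsQLogDeriv] at hL hL' ⊢
      simp [hL, hL']
    · have ht : IsTraceClass (star (K X)) := by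
        rw [show K X = φ.op from hX]; exact hφ.1.1.star
      have e : ⟪φ, ((p + q).2 : HS H)⟫_ℂ = ⟪φ, (p.2 : HS H)⟫_ℂ + ⟪φ, (q.2 : HS H)⟫_ℂ := by
        simp
      rw [e, h2 φ hφ X hX, h2' φ hφ X hX, mul_add,
        opTrace_add (ht.mul_right _) (ht.mul_right _)]
  smul_mem' := by
    rintro c p ⟨h1, L, hL, h2⟩
    refine ⟨(T0sa H).smul_mem c h1, (c : ℂ) • L, ?_, fun φ hφ X hX => ?_⟩
    · simp only [IsQLogDeriv] at hL ⊢
      have e : (((c • p).1 : XiR H) : HS H) = (c : ℂ) • (p.1 : HS H) := rfl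
      rw [e, map_smul, map_smul, hL]
    · have e : ⟪φ, ((c • p).2 : HS H)⟫_ℂ = (c : ℂ) * ⟪φ, (p.2 : HS H)⟫_ℂ := by
        have e' : (((c • p).2 : XiR H) : HS H) = (c : ℂ) • (p.2 : HS H) := rfl
        rw [e', inner_smul_right]
      rw [e, h2 φ hφ X hX, mul_smul_comm, opTrace_smul]

/-- The RLD Fisher information operator `J^R` at the state `ρ`, an operator on `Ξ̃`
(unbounded when `H` is infinite-dimensional). -/
def fisherR (ρ : DensityOperator H) : XiC H →ₗ.[ℂ] XiC H := (fisherGraphC (KR ρ.op)).toLinearPMap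

/-- The SLD Fisher information operator `J^S` at the state `ρ`, an operator on `Ξ`
(unbounded when `H` is infinite-dimensional). -/
def fisherS (ρ : DensityOperator H) : XiR H →ₗ.[ℝ] XiR H := (fisherGraphR (KS ρ.op)).toLinearPMap

end QuantumFisher

/-! ### Measurements and the classical Fisher information operator -/

section Measurement

open MeasureTheory

variable {H : Type*} [NormedAddCommGroup H] [InnerProductSpace ℂ H] [CompleteSpace H]
  {Ω : Type*} [MeasurableSpace Ω]

/-- Positive operator-valued measures on `Ω`. -/
structure POVM (Ω : Type*) [MeasurableSpace Ω] (H : Type*) [NormedAddCommGroup H]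
    [InnerProductSpace ℂ H] [CompleteSpace H] where
  effect : Set Ω → (H →L[ℂ] H)
  isPositive : ∀ B, MeasurableSet B → (effect B).IsPositive
  univ : effect Set.univ = 1
  iUnion : ∀ f : ℕ → Set Ω, (∀ n, MeasurableSet (f n)) → Pairwise (Function.onFun Disjoint f) →
    ∀ x y, HasSum (fun n => ⟪x, effect (f n) y⟫_ℂ) ⟪x, effect (⋃ n, f n) y⟫_ℂ

lemma exists_sqrt {M : H →L[ℂ] H} (hM : M.IsPositive) :
    ∃ S : H →L[ℂ] H, star S = S ∧ S * S = M := by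
  have h0 : 0 ≤ M := (ContinuousLinearMap.nonneg_iff_isPositive M).2 hM
  exact ⟨CFC.sqrt M, (IsSelfAdjoint.of_nonneg (CFC.sqrt_nonneg M)).star_eq,
    CFC.sqrt_mul_sqrt_self M h0⟩

lemma inner_sqrt {S : H →L[ℂ] H} (hS : star S = S) (x y : H) :
    ⟪x, (S * S) y⟫_ℂ = ⟪S x, S y⟫_ℂ := by
  rw [mul_apply_eq_comp, ← ContinuousLinearMap.adjoint_inner_left,
    ← ContinuousLinearMap.star_eq_adjoint, hS]

lemma opTrace_mul {T : H →L[ℂ] H} {x y : ℕ → H} (hs : Summable (fun n => ‖x n‖ * ‖y n‖))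
    (hT : ∀ z, HasSum (fun n => ⟪x n, z⟫_ℂ • y n) (T z)) (S : H →L[ℂ] H) :
    opTrace (T * S) = ∑' n, ⟪x n, S (y n)⟫_ℂ := by
  have h1 : Summable (fun n => ‖star S (x n)‖ * ‖y n‖) := by
    refine Summable.of_nonneg_of_le (fun n => by positivity) (fun n => ?_) (hs.mul_left ‖star S‖)
    rw [← mul_assoc]
    gcongr
    exact ContinuousLinearMap.le_opNorm _ _
  have h2 : ∀ z, HasSum (fun n => ⟪star S (x n), z⟫_ℂ • y n) ((T * S) z) := fun z => by
    simpa [ContinuousLinearMap.star_eq_adjoint, ContinuousLinearMap.adjoint_inner_left]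
      using hT (S z)
  rw [opTrace, (hasSum_diag h1 h2).tsum_eq]
  simp [ContinuousLinearMap.star_eq_adjoint, ContinuousLinearMap.adjoint_inner_left]

lemma opTrace_mul_nonneg (ρ : DensityOperator H) {M : H →L[ℂ] H} (hM : M.IsPositive) :
    0 ≤ (opTrace (ρ.op * M)).re := by
  obtain ⟨x, y, hs, hT⟩ := ρ.isTraceClass
  obtain ⟨S, hS, rfl⟩ := exists_sqrt hM
  have h1 : Summable (fun n => ‖S (x n)‖ * ‖S (y n)‖) := by
    refine Summable.of_nonneg_of_le (fun n => by positivity) (fun n => ?_)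
      (hs.mul_left (‖S‖ * ‖S‖))
    calc ‖S (x n)‖ * ‖S (y n)‖ ≤ (‖S‖ * ‖x n‖) * (‖S‖ * ‖y n‖) := by
          gcongr <;> exact ContinuousLinearMap.le_opNorm _ _
      _ = _ := by ring
  have h2 : ∀ z, HasSum (fun n => ⟪S (x n), z⟫_ℂ • S (y n)) ((S * ρ.op * S) z) := fun z => by
    have := (hT (S z)).mapL S
    have e : ∀ n, ⟪S (x n), z⟫_ℂ = ⟪x n, S z⟫_ℂ := fun n => by
      rw [← ContinuousLinearMap.adjoint_inner_left, ← ContinuousLinearMap.star_eq_adjoint, hS]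
    simpa [e] using this
  have h3 := hasSum_diag h1 h2
  have e : opTrace (ρ.op * (S * S)) = ∑' i, ⟪onb H i, (S * ρ.op * S) (onb H i)⟫_ℂ := by
    rw [opTrace_mul hs hT, h3.tsum_eq]
    exact tsum_congr fun n => inner_sqrt hS _ _
  rw [e, Complex.re_tsum h3.summable]
  refine tsum_nonneg fun i => ?_
  have : ⟪onb H i, (S * ρ.op * S) (onb H i)⟫_ℂ = ⟪S (onb H i), ρ.op (S (onb H i))⟫_ℂ := by
    rw [mul_apply_eq_comp, mul_apply_eq_comp,
      ← ContinuousLinearMap.adjoint_inner_left, ← ContinuousLinearMap.star_eq_adjoint, hS]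
  rw [this]
  exact ρ.isPositive.re_inner_nonneg_right _

lemma POVM.summable_inner (M : POVM Ω H) {f : ℕ → Set Ω} (hf : ∀ n, MeasurableSet (f n))
    (hd : Pairwise (Function.onFun Disjoint f)) (x y : H) :
    Summable (fun n => ‖⟪x, M.effect (f n) y⟫_ℂ‖) ∧
      ∑' n, ‖⟪x, M.effect (f n) y⟫_ℂ‖ ≤ ‖M.effect (⋃ n, f n)‖ * (‖x‖ * ‖y‖) := by
  choose S hS hSS using fun n => exists_sqrt (M.isPositive (f n) (hf n))
  have hsq : ∀ z : H, HasSum (fun n => ‖S n z‖ ^ 2) (⟪z, M.effect (⋃ n, f n) z⟫_ℂ).re := fun z => by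
    have := (Complex.hasSum_re (M.iUnion f hf hd z z))
    convert this using 2 with n
    rw [← hSS n, inner_sqrt (hS n), inner_self_eq_norm_sq_to_K]
    norm_cast
  have hle : ∀ z : H, (⟪z, M.effect (⋃ n, f n) z⟫_ℂ).re ≤ ‖M.effect (⋃ n, f n)‖ * ‖z‖ ^ 2 :=
    fun z => calc
      (⟪z, M.effect (⋃ n, f n) z⟫_ℂ).re ≤ ‖⟪z, M.effect (⋃ n, f n) z⟫_ℂ‖ := Complex.re_le_norm _
      _ ≤ ‖z‖ * ‖M.effect (⋃ n, f n) z‖ := norm_inner_le_norm _ _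
      _ ≤ ‖z‖ * (‖M.effect (⋃ n, f n)‖ * ‖z‖) := by
          gcongr; exact ContinuousLinearMap.le_opNorm _ _
      _ = _ := by ring
  have key := Real.inner_le_Lp_mul_Lq_tsum_of_nonneg (p := 2) (q := 2)
    (f := fun n => ‖S n x‖) (g := fun n => ‖S n y‖)
    Real.HolderConjugate.two_two (fun i => norm_nonneg _) (fun i => norm_nonneg _)
    (by simpa using (hsq x).summable) (by simpa using (hsq y).summable)
  have key' := Real.summable_mul_of_Lp_Lq_of_nonneg (p := 2) (q := 2)
    (f := fun n => ‖S n x‖) (g := fun n => ‖S n y‖)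
    Real.HolderConjugate.two_two (fun i => norm_nonneg _) (fun i => norm_nonneg _)
    (by simpa using (hsq x).summable) (by simpa using (hsq y).summable)
  have hb : ∀ n, ‖⟪x, M.effect (f n) y⟫_ℂ‖ ≤ ‖S n x‖ * ‖S n y‖ := fun n => by
    rw [← hSS n, inner_sqrt (hS n)]
    exact norm_inner_le_norm _ _
  have hsum := Summable.of_nonneg_of_le (fun n => norm_nonneg _) hb key'
  refine ⟨hsum, (hsum.tsum_le_tsum hb key').trans (key.trans ?_)⟩
  have hC := norm_nonneg (M.effect (⋃ n, f n))
  have ex : (∑' n, ‖S n x‖ ^ (2 : ℝ)) ^ (1 / 2 : ℝ) ≤ √‖M.effect (⋃ n, f n)‖ * ‖x‖ := by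
    rw [← Real.sqrt_eq_rpow]
    refine Real.sqrt_le_iff.2 ⟨by positivity, ?_⟩
    rw [mul_pow, Real.sq_sqrt hC]
    simpa [(hsq x).tsum_eq] using hle x
  have ey : (∑' n, ‖S n y‖ ^ (2 : ℝ)) ^ (1 / 2 : ℝ) ≤ √‖M.effect (⋃ n, f n)‖ * ‖y‖ := by
    rw [← Real.sqrt_eq_rpow]
    refine Real.sqrt_le_iff.2 ⟨by positivity, ?_⟩
    rw [mul_pow, Real.sq_sqrt hC]
    simpa [(hsq y).tsum_eq] using hle y
  calc _ ≤ (√‖M.effect (⋃ n, f n)‖ * ‖x‖) * (√‖M.effect (⋃ n, f n)‖ * ‖y‖) := by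
        refine mul_le_mul ex ey ?_ (by positivity)
        exact Real.rpow_nonneg (tsum_nonneg fun n => by positivity) _
    _ = _ := by
        nth_rewrite 3 [← Real.mul_self_sqrt hC]
        ring

lemma POVM.hasSum_opTrace (M : POVM Ω H) (ρ : DensityOperator H) {f : ℕ → Set Ω}
    (hf : ∀ n, MeasurableSet (f n)) (hd : Pairwise (Function.onFun Disjoint f)) :
    HasSum (fun n => opTrace (ρ.op * M.effect (f n)))
      (opTrace (ρ.op * M.effect (⋃ n, f n))) := by
  obtain ⟨x, y, hs, hT⟩ := ρ.isTraceClass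
  simp only [opTrace_mul hs hT]
  let g : ℕ × ℕ → ℂ := fun p => ⟪x p.1, M.effect (f p.2) (y p.1)⟫_ℂ
  have hg : Summable g := by
    apply Summable.of_norm
    refine (summable_prod_of_nonneg (fun p => norm_nonneg _)).2
      ⟨fun k => (M.summable_inner hf hd (x k) (y k)).1, ?_⟩
    exact Summable.of_nonneg_of_le (fun k => tsum_nonneg fun n => norm_nonneg _)
      (fun k => (M.summable_inner hf hd (x k) (y k)).2) (hs.mul_left _)
  have h1 := hg.hasSum.prod_fiberwise (fun k => M.iUnion f hf hd (x k) (y k))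
  have hsw : HasSum (fun p : ℕ × ℕ => g p.swap) (∑' p, g p) :=
    (Equiv.prodComm _ _).hasSum_iff.2 hg.hasSum
  rw [h1.tsum_eq]
  exact hsw.prod_fiberwise (fun n => (hsw.summable.prod_factor n).hasSum)

/-- The outcome distribution `P(B) = Tr[ρ M(B)]` of the measurement `M` in the state `ρ`. -/
def POVM.prob (M : POVM Ω H) (ρ : DensityOperator H) : Measure Ω :=
  Measure.ofMeasurable (fun B _ => ENNReal.ofReal (opTrace (ρ.op * M.effect B)).re)
    (by
      have h := M.hasSum_opTrace ρ (f := fun _ => ∅) (fun _ => .empty)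
        (fun i j _ => by simp [Function.onFun])
      have h0 := h.summable
      rw [summable_const_iff] at h0
      simp [h0])
    (by
      intro f hf hd
      have h := Complex.hasSum_re (M.hasSum_opTrace ρ hf hd)
      rw [← h.tsum_eq]
      exact ENNReal.ofReal_tsum_of_nonneg
        (fun n => opTrace_mul_nonneg ρ (M.isPositive _ (hf n))) h.summable)

/-- `l` is the logarithmic derivative at `ρ` of the outcome distribution in the direction `φ`:
the Radon-Nikodym derivative of `B ↦ D_θ P_θ(B)[φ] = Tr[φ M(B)]` with respect to `P`. -/
def POVM.IsLogDeriv (M : POVM Ω H) (ρ : DensityOperator H) (φ : HS H) (l : Ω → ℝ) : Prop :=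
  Integrable l (M.prob ρ) ∧
    ∀ B, MeasurableSet B → ∫ ω in B, l ω ∂(M.prob ρ) = (opTrace (φ.op * M.effect B)).re

/-- The graph of the classical Fisher information operator `J^M` of the outcome distribution:
`J φ = ψ` iff `(χ, ψ) = E[l(χ) l(φ)]` for all directions `χ` whose logarithmic derivative is
square integrable. -/
def POVM.fisherGraph (M : POVM Ω H) (ρ : DensityOperator H) : Submodule ℝ (XiR H × XiR H) where
  carrier := {p | (p.1 : HS H) ∈ T0sa H ∧ ∃ l, M.IsLogDeriv ρ p.1 l ∧ MemLp l 2 (M.prob ρ) ∧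
    ∀ χ ∈ T0sa H, ∀ m, M.IsLogDeriv ρ χ m → MemLp m 2 (M.prob ρ) →
      ⟪χ, (p.2 : HS H)⟫_ℝ = ∫ ω, m ω * l ω ∂(M.prob ρ)}
  zero_mem' := by
    refine ⟨zero_mem _, 0, ⟨integrable_zero _ _ _, fun B _ => ?_⟩, MemLp.zero, fun χ _ m _ _ => ?_⟩
    · simp [opTrace_zero]
    · simp
  add_mem' := by
    rintro p q ⟨h1, l, ⟨hi, hl⟩, h2, h3⟩ ⟨h1', l', ⟨hi', hl'⟩, h2', h3'⟩
    refine ⟨add_mem h1 h1', l + l', ⟨hi.add hi', fun B hB => ?_⟩, h2.add h2', fun χ hχ m hm hm2 => ?_⟩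
    · have e : (((p + q).1 : XiR H) : HS H).op = (p.1 : HS H).op + (q.1 : HS H).op := by simp
      rw [e, add_mul, opTrace_add (h1.1.1.mul_right _) (h1'.1.1.mul_right _), Complex.add_re,
        ← hl B hB, ← hl' B hB]
      exact integral_add hi.integrableOn hi'.integrableOn
    · have e : ⟪χ, ((p + q).2 : HS H)⟫_ℝ = ⟪χ, (p.2 : HS H)⟫_ℝ + ⟪χ, (q.2 : HS H)⟫_ℝ := by
        simp [inner_add_right]
      rw [e, h3 χ hχ m hm hm2, h3' χ hχ m hm hm2,
        ← integral_add (f := fun ω => m ω * l ω) (g := fun ω => m ω * l' ω)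
          (hm2.integrable_mul h2) (hm2.integrable_mul h2')]
      simp [mul_add]
  smul_mem' := by
    rintro c p ⟨h1, l, ⟨hi, hl⟩, h2, h3⟩
    refine ⟨(T0sa H).smul_mem c h1, c • l, ⟨hi.smul c, fun B hB => ?_⟩, h2.const_smul c,
      fun χ hχ m hm hm2 => ?_⟩
    · have e : (((c • p).1 : XiR H) : HS H).op = (c : ℂ) • (p.1 : HS H).op := by
        have e' : (((c • p).1 : XiR H) : HS H) = (c : ℂ) • (p.1 : HS H) := rfl
        rw [e', map_smul]
      rw [e, smul_mul_assoc, opTrace_smul, Complex.re_ofReal_mul, ← hl B hB]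
      simp [integral_const_mul]
    · have e : ⟪χ, ((c • p).2 : HS H)⟫_ℝ = c * ⟪χ, (p.2 : HS H)⟫_ℝ := by
        have e' : (((c • p).2 : XiR H) : HS H) = c • (p.2 : HS H) := rfl
        rw [e', inner_smul_right]
      rw [e, h3 χ hχ m hm hm2, ← integral_const_mul]
      congr 1
      ext ω
      simp
      ring

/-- The classical Fisher information operator `J^M` on `Ξ` of the measurement `M` at `ρ`. -/
def POVM.fisher (M : POVM Ω H) (ρ : DensityOperator H) : XiR H →ₗ.[ℝ] XiR H :=
  (M.fisherGraph ρ).toLinearPMap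

/-- `(ker J^M)ᗮ`: the kernel in `Ξ̃` of the complex linear extension of `J^M` is the complex
span of the kernel of `J^M` in `Ξ`. -/
def POVM.fisherKerPerp (M : POVM Ω H) (ρ : DensityOperator H) : Submodule ℂ (HS H) :=
  (Submodule.span ℂ ((fun φ : XiR H => (φ : HS H)) '' (pker (M.fisher ρ) : Set (XiR H))))ᗮ

end Measurement

end QEst

end

noncomputable section

namespace QEst

set_option linter.unusedSectionVars false

variable {H : Type*} [NormedAddCommGroup H] [InnerProductSpace ℂ H] [CompleteSpace H]

/-! ### The trace -/

/-! The core is `IsGradient.exists_eq`: at a strictly positive ρ, an observable whose expectation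
has a gradient a is a restriction of the bounded operator a* + c. Let T be the trace class extension
of ρA, and take X self-adjoint with Tr[Xρ²] = 0. The direction φ = ρXρ is self-adjoint of trace
zero, ρ + tφ stays strictly positive for small t (`IsStrictlyPos.eventually_add`), and (ρ + tφ)A
extends to T + tρXT. Differentiating along this line gives Tr[ρXT] = (a, φ), that is, Tr[X(Tρ -
ρa*ρ)] = 0. By `eq_smul_of_opTrace_mul_eq_zero`, Tρ - ρa*ρ = cρ². Cancelling ρ on the right and then
on the left leaves A = a* + c on dom A.

Now everything is bounded. The constants drop out of the covariance, which becomes Tr[ρLb*] with L =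
a - Tr[ρa] (`cov_eq_opTrace_centered`). The direction χ = ρL has trace zero and logarithmic
derivative L. Since trace-zero directions do not see constants, J^R χ = a. Strict positivity makes
J^R well defined and injective, so (J^R)⁺a = χ, and (b, χ) = Tr[b*ρL] is the covariance.

For self-adjoint observables the same argument runs with χ = (ρL + Lρ)/2. The gradients are then
self-adjoint, because a - a* is a multiple of the identity and the closure of the trace-zero
operators contains no nonzero one. -/

lemma opTrace_mul_comm {T : H →L[ℂ] H} (hT : IsTraceClass T) (S : H →L[ℂ] H) :
    opTrace (T * S) = opTrace (S * T) := by
  obtain ⟨x, y, hs, hT⟩ := hT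
  have h1 : Summable (fun n => ‖x n‖ * ‖S (y n)‖) := by
    refine Summable.of_nonneg_of_le (fun n => by positivity) (fun n => ?_) (hs.mul_left ‖S‖)
    calc ‖x n‖ * ‖S (y n)‖ ≤ ‖x n‖ * (‖S‖ * ‖y n‖) := by
          gcongr; exact ContinuousLinearMap.le_opNorm _ _
      _ = _ := by ring
  have h2 : ∀ z, HasSum (fun n => ⟪x n, z⟫_ℂ • S (y n)) ((S * T) z) := fun z => by
    simpa using (hT z).mapL S
  -- Both traces equal ∑ₙ ⟨xₙ, S yₙ⟩.
  rw [opTrace_mul hs hT, opTrace, (hasSum_diag h1 h2).tsum_eq]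

/-- No trace class hypothesis is needed: conjugation commutes with `tsum` even for a series that is
not summable, where both sides are 0. -/
lemma opTrace_star (T : H →L[ℂ] H) : opTrace (star T) = (starRingEnd ℂ) (opTrace T) := by
  rw [opTrace, opTrace, Complex.conj_tsum]
  refine tsum_congr fun i => ?_
  rw [ContinuousLinearMap.star_eq_adjoint, ContinuousLinearMap.adjoint_inner_right,
    inner_conj_symm]

lemma IsTraceClass.neg {T : H →L[ℂ] H} (hT : IsTraceClass T) : IsTraceClass (-T) := by
  simpa using hT.smul (-1)

lemma IsTraceClass.sub {S T : H →L[ℂ] H} (hS : IsTraceClass S) (hT : IsTraceClass T) :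
    IsTraceClass (S - T) := by
  simpa [sub_eq_add_neg] using hS.add hT.neg

lemma opTrace_neg (T : H →L[ℂ] H) : opTrace (-T) = -opTrace T := by
  simpa using opTrace_smul (-1) T

lemma opTrace_sub {S T : H →L[ℂ] H} (hS : IsTraceClass S) (hT : IsTraceClass T) :
    opTrace (S - T) = opTrace S - opTrace T := by
  rw [sub_eq_add_neg, opTrace_add hS hT.neg, opTrace_neg, sub_eq_add_neg]

lemma inner_star_mul_self (T : H →L[ℂ] H) (x : H) :
    ⟪x, (star T * T) x⟫_ℂ = ((‖T x‖ ^ 2 : ℝ) : ℂ) := by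
  rw [mul_apply_eq_comp, ContinuousLinearMap.star_eq_adjoint,
    ContinuousLinearMap.adjoint_inner_right, inner_self_eq_norm_sq_to_K]
  norm_cast

/-- A trace class operator is a Hilbert-Schmidt operator. -/
def HS.ofTraceClass (T : H →L[ℂ] H) (hT : IsTraceClass T) : HS H :=
  ⟨T, by
    have h := (hT.mul_left (star T)).summable_diag
    simp only [inner_star_mul_self] at h
    exact Complex.summable_ofReal.1 h⟩

@[simp] lemma HS.op_ofTraceClass (T : H →L[ℂ] H) (hT : IsTraceClass T) :
    (HS.ofTraceClass T hT).op = T := rfl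

lemma HS.inner_eq_opTrace (S T : HS H) : ⟪S, T⟫_ℂ = opTrace (star S.op * T.op) := by
  refine tsum_congr fun i => ?_
  rw [mul_apply_eq_comp, ContinuousLinearMap.star_eq_adjoint,
    ContinuousLinearMap.adjoint_inner_right]

lemma ext_onb {S T : H →L[ℂ] H} (h : ∀ i, S (onb H i) = T (onb H i)) : S = T := by
  refine ContinuousLinearMap.ext_on (s := Set.range (onb H)) ?_ ?_
  · rw [Submodule.dense_iff_topologicalClosure_eq_top]
    exact (onb H).dense_span
  · rintro _ ⟨i, rfl⟩
    exact h i

/-- Tr[T*T] is the squared Hilbert-Schmidt norm of T. -/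
lemma eq_zero_of_opTrace_star_mul_self {T : H →L[ℂ] H} (hT : IsTraceClass T)
    (h : opTrace (star T * T) = 0) : T = 0 := by
  rw [← HS.op_ofTraceClass T hT, ← HS.inner_eq_opTrace] at h
  rw [← HS.op_ofTraceClass T hT, inner_self_eq_zero.1 h, map_zero]

/-- A trace class operator that pairs to zero with all self-adjoint operators vanishes. -/
lemma eq_zero_of_opTrace_mul_selfAdjoint {T : H →L[ℂ] H} (hT : IsTraceClass T)
    (h : ∀ X : H →L[ℂ] H, IsSelfAdjoint X → opTrace (X * T) = 0) : T = 0 := by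
  refine eq_zero_of_opTrace_star_mul_self hT ?_
  -- Split T* into self-adjoint parts, so that Tr[T*T] is a combination of two pairings that vanish
  -- by hypothesis.
  have e := realPart_add_I_smul_imaginaryPart (star T)
  rw [← e, add_mul, smul_mul_assoc, opTrace_add (hT.mul_left _) ((hT.mul_left _).smul _),
    opTrace_smul, h _ (realPart (star T)).2, h _ (imaginaryPart (star T)).2]
  simp

/-- If `Tr[X P] = 0` implies `Tr[X T] = 0` for self-adjoint `X`, then `T` is a multiple of `P`. -/
lemma eq_smul_of_opTrace_mul_eq_zero {P T : H →L[ℂ] H} (hP : IsTraceClass P)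
    (hPs : IsSelfAdjoint P) (hP0 : opTrace P ≠ 0) (hT : IsTraceClass T)
    (h : ∀ X : H →L[ℂ] H, IsSelfAdjoint X → opTrace (X * P) = 0 → opTrace (X * T) = 0) :
    ∃ c : ℂ, T = c • P := by
  refine ⟨opTrace T / opTrace P, sub_eq_zero.1 ?_⟩
  refine eq_zero_of_opTrace_mul_selfAdjoint (hT.sub (hP.smul _)) fun X hX => ?_
  -- Subtracting the constant Tr[XP]/Tr[P] from X makes its pairing with P vanish. The constant is
  -- real, so the shifted operator is still self-adjoint and the hypothesis applies to it.
  have hr : IsSelfAdjoint (opTrace (X * P) / opTrace P) := by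
    have h1 : (starRingEnd ℂ) (opTrace (X * P)) = opTrace (X * P) := by
      rw [← opTrace_star, star_mul, hPs.star_eq, hX.star_eq, opTrace_mul_comm hP]
    have h2 : (starRingEnd ℂ) (opTrace P) = opTrace P := by rw [← opTrace_star, hPs.star_eq]
    rw [IsSelfAdjoint, ← starRingEnd_apply, map_div₀, h1, h2]
  have hY := h (X - (opTrace (X * P) / opTrace P) • 1) (hX.sub (hr.smul (.one _))) (by
    rw [sub_mul, smul_mul_assoc, one_mul, opTrace_sub (hP.mul_left _) (hP.smul _), opTrace_smul]
    field_simp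
    simp)
  rw [sub_mul, smul_mul_assoc, one_mul, opTrace_sub (hT.mul_left _) (hT.smul _), opTrace_smul,
    sub_eq_zero] at hY
  rw [mul_sub, mul_smul_comm, opTrace_sub (hT.mul_left _) ((hP.mul_left _).smul _), opTrace_smul,
    hY]
  field_simp
  simp

/-! ### Strictly positive operators -/

lemma IsStrictlyPos.isSelfAdjoint {ρ : H →L[ℂ] H} (hρ : IsStrictlyPos ρ) : IsSelfAdjoint ρ :=
  hρ.1.isSelfAdjoint

lemma IsStrictlyPos.eq_zero_of_apply {ρ : H →L[ℂ] H} (hρ : IsStrictlyPos ρ) {x : H}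
    (h : ρ x = 0) : x = 0 := by
  by_contra hx
  simpa [h] using hρ.2 x hx

lemma IsStrictlyPos.eq_zero_of_mul_left {ρ X : H →L[ℂ] H} (hρ : IsStrictlyPos ρ)
    (h : ρ * X = 0) : X = 0 := by
  ext x
  exact hρ.eq_zero_of_apply (congrArg (fun T : H →L[ℂ] H => T x) h)

/-- Since ρ is self-adjoint, taking adjoints turns right cancellation into left cancellation. -/
lemma IsStrictlyPos.eq_zero_of_mul_right {ρ X : H →L[ℂ] H} (hρ : IsStrictlyPos ρ)
    (h : X * ρ = 0) : X = 0 := by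
  have h' : ρ * star X = 0 := by rw [← hρ.isSelfAdjoint.star_eq, ← star_mul, h, star_zero]
  rw [← star_star X, hρ.eq_zero_of_mul_left h', star_zero]

lemma IsStrictlyPos.opTrace_nonneg {ρ : H →L[ℂ] H} (hρ : IsStrictlyPos ρ) (ht : IsTraceClass ρ)
    (X : H →L[ℂ] H) : 0 ≤ (opTrace (star X * ρ * X)).re := by
  have hs := (ht.mul (star X) X).summable_diag
  rw [opTrace, Complex.re_tsum hs]
  refine tsum_nonneg fun i => ?_
  rw [mul_apply_eq_comp, mul_apply_eq_comp,
    ContinuousLinearMap.star_eq_adjoint, ContinuousLinearMap.adjoint_inner_right]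
  exact hρ.1.re_inner_nonneg_right _

/-- `Tr[X* ρ X] = 0` forces `X = 0` when `ρ > 0`. -/
lemma IsStrictlyPos.eq_zero_of_opTrace {ρ X : H →L[ℂ] H} (hρ : IsStrictlyPos ρ)
    (ht : IsTraceClass ρ) (h : (opTrace (star X * ρ * X)).re = 0) : X = 0 := by
  have hs := (ht.mul (star X) X).summable_diag
  have e : ∀ i, ⟪onb H i, (star X * ρ * X) (onb H i)⟫_ℂ
      = ⟪X (onb H i), ρ (X (onb H i))⟫_ℂ := fun i => by
    rw [mul_apply_eq_comp, mul_apply_eq_comp,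
      ContinuousLinearMap.star_eq_adjoint, ContinuousLinearMap.adjoint_inner_right]
  have hs' := Complex.hasSum_re hs.hasSum
  change HasSum _ (opTrace (star X * ρ * X)).re at hs'
  simp only [e, h] at hs'
  -- The trace is a sum of the nonnegative terms ⟨Xeᵢ, ρXeᵢ⟩, so each term vanishes, and strict
  -- positivity gives Xeᵢ = 0.
  have h0 := (hasSum_zero_iff_of_nonneg fun i => hρ.1.re_inner_nonneg_right _).1 hs'
  refine ext_onb fun i => ?_
  by_contra hx
  exact (hρ.2 _ hx).ne' (congrFun h0 i)

lemma KR_apply (ρ X : H →L[ℂ] H) : KR ρ X = ρ * X := rfl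

lemma KS_apply (ρ X : H →L[ℂ] H) : KS ρ X = (1 / 2 : ℂ) • (ρ * X + X * ρ) := rfl

/-- `Tr[(K^S X)* X] = 0` forces `X = 0` when `ρ > 0`. -/
lemma IsStrictlyPos.eq_zero_of_opTrace_KS {ρ X : H →L[ℂ] H} (hρ : IsStrictlyPos ρ)
    (ht : IsTraceClass ρ) (h : opTrace (star (KS ρ X) * X) = 0) : X = 0 := by
  -- By cyclicity this trace is the mean of Tr[X*ρX] and Tr[XρX*]. Both are nonnegative, so both
  -- vanish with the sum.
  have h1 : opTrace (star (KS ρ X) * X)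
      = (1 / 2 : ℂ) * (opTrace (star X * ρ * X) + opTrace (star (star X) * ρ * star X)) := by
    have e : opTrace (star (star X) * ρ * star X) = opTrace (ρ * star X * X) := by
      rw [star_star, mul_assoc, opTrace_mul_comm (ht.mul_right _)]
    rw [KS_apply, star_smul, star_add, star_mul, star_mul, hρ.isSelfAdjoint.star_eq,
      smul_mul_assoc, opTrace_smul, add_mul, opTrace_add (ht.mul (star X) X)
        ((ht.mul_right _).mul_right _), e]
    simp
  rw [h1] at h
  have h2 : opTrace (star X * ρ * X) + opTrace (star (star X) * ρ * star X) = 0 := by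
    simpa using h
  have h3 := congrArg Complex.re h2
  rw [Complex.add_re, Complex.zero_re] at h3
  have h4 := hρ.opTrace_nonneg ht X
  have h5 := hρ.opTrace_nonneg ht (star X)
  exact hρ.eq_zero_of_opTrace ht (by linarith)

lemma IsStrictlyPos.eq_zero_of_KS {ρ X : H →L[ℂ] H} (hρ : IsStrictlyPos ρ)
    (ht : IsTraceClass ρ) (h : KS ρ X = 0) : X = 0 :=
  hρ.eq_zero_of_opTrace_KS ht (by rw [h, star_zero, zero_mul, opTrace_zero])

/-- Small perturbations `ρ + t ρ X ρ` of a strictly positive operator are strictly positive. -/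
lemma IsStrictlyPos.eventually_add {ρ X : H →L[ℂ] H} (hρ : IsStrictlyPos ρ)
    (hX : IsSelfAdjoint X) :
    ∀ᶠ t : ℝ in 𝓝 0, IsStrictlyPos (ρ + (t : ℂ) • (ρ * X * ρ)) := by
  -- With S = √ρ one has ⟨x, ρx⟩ = ‖Sx‖² and |⟨ρx, Xρx⟩| ≤ ‖X‖‖S‖²‖Sx‖². The perturbation is thus
  -- bounded relative to the form of ρ, and |t|‖X‖‖S‖² < 1 suffices.
  obtain ⟨S, hS, hSS⟩ := exists_sqrt hρ.1
  have hlim : Filter.Tendsto (fun t : ℝ => |t| * (‖X‖ * ‖S‖ ^ 2)) (𝓝 0) (𝓝 0) := by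
    have : Continuous (fun t : ℝ => |t| * (‖X‖ * ‖S‖ ^ 2)) := by fun_prop
    simpa using this.tendsto 0
  filter_upwards [hlim.eventually_lt_const (zero_lt_one)] with t ht
  have hsa : IsSelfAdjoint (ρ + (t : ℂ) • (ρ * X * ρ)) := by
    refine hρ.isSelfAdjoint.add (IsSelfAdjoint.smul (by simp [IsSelfAdjoint]) ?_)
    simp [IsSelfAdjoint, star_mul, hρ.isSelfAdjoint.star_eq, hX.star_eq, mul_assoc]
  have hlow : ∀ x, (1 - |t| * (‖X‖ * ‖S‖ ^ 2)) * ‖S x‖ ^ 2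
      ≤ (⟪x, (ρ + (t : ℂ) • (ρ * X * ρ)) x⟫_ℂ).re := fun x => by
    have e1 : (⟪x, ρ x⟫_ℂ).re = ‖S x‖ ^ 2 := by
      rw [← hSS, inner_sqrt hS, inner_self_eq_norm_sq_to_K]
      norm_cast
    have e2 : ⟪x, (ρ * X * ρ) x⟫_ℂ = ⟪ρ x, X (ρ x)⟫_ℂ := by
      rw [mul_apply_eq_comp, mul_apply_eq_comp,
        ← ContinuousLinearMap.adjoint_inner_left, ← ContinuousLinearMap.star_eq_adjoint,
        hρ.isSelfAdjoint.star_eq]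
    have e3 : ‖ρ x‖ ≤ ‖S‖ * ‖S x‖ := by
      rw [← hSS, mul_apply_eq_comp]
      exact S.le_opNorm _
    have e4 : |(⟪ρ x, X (ρ x)⟫_ℂ).re| ≤ ‖X‖ * ‖S‖ ^ 2 * ‖S x‖ ^ 2 := calc
      _ ≤ ‖⟪ρ x, X (ρ x)⟫_ℂ‖ := Complex.abs_re_le_norm _
      _ ≤ ‖ρ x‖ * ‖X (ρ x)‖ := norm_inner_le_norm _ _
      _ ≤ ‖ρ x‖ * (‖X‖ * ‖ρ x‖) := by gcongr; exact X.le_opNorm _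
      _ = ‖X‖ * ‖ρ x‖ ^ 2 := by ring
      _ ≤ ‖X‖ * (‖S‖ * ‖S x‖) ^ 2 := by gcongr
      _ = _ := by ring
    have e5 : |t * (⟪ρ x, X (ρ x)⟫_ℂ).re| ≤ |t| * (‖X‖ * ‖S‖ ^ 2 * ‖S x‖ ^ 2) := by
      rw [abs_mul]
      gcongr
    rw [add_apply, smul_apply, inner_add_right,
      inner_smul_right, e2, Complex.add_re, Complex.re_ofReal_mul, e1]
    have := neg_abs_le (t * (⟪ρ x, X (ρ x)⟫_ℂ).re)
    linarith
  refine ⟨(ContinuousLinearMap.isPositive_def' ).2 ⟨hsa, fun x => ?_⟩, fun x hx => ?_⟩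
  · rw [ContinuousLinearMap.reApplyInnerSelf_apply, ← inner_re_symm]
    exact le_trans (mul_nonneg (by linarith) (by positivity)) (hlow x)
  · refine lt_of_lt_of_le (mul_pos (by linarith) ?_) (hlow x)
    have : S x ≠ 0 := fun h0 => hx (hρ.eq_zero_of_apply (by
      rw [← hSS, mul_apply_eq_comp, h0, map_zero]))
    positivity

/-! ### The adjoint of a Hilbert-Schmidt operator -/

lemma hasSum_sq_inner_onb (x : H) : HasSum (fun i => ‖⟪onb H i, x⟫_ℂ‖ ^ 2) (‖x‖ ^ 2) := by
  have e : ‖x‖ ^ 2 = (⟪x, x⟫_ℂ).re := by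
    rw [inner_self_eq_norm_sq_to_K]
    norm_cast
  rw [e]
  refine (Complex.hasSum_re ((onb H).hasSum_inner_mul_inner x x)).congr_fun fun i => ?_
  rw [← inner_conj_symm x, ← Complex.normSq_eq_conj_mul_self, Complex.ofReal_re,
    Complex.normSq_eq_norm_sq]

/-- By Parseval both sums are iterated sums of |⟨eⱼ, T eᵢ⟩|², and nonnegativity allows the order of
summation to be exchanged. -/
lemma hasSum_star_sq {T : H →L[ℂ] H} {s : ℝ} (h : HasSum (fun i => ‖T (onb H i)‖ ^ 2) s) :
    HasSum (fun i => ‖(star T) (onb H i)‖ ^ 2) s := by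
  let f : basisIndex H × basisIndex H → ℝ := fun p => ‖⟪onb H p.2, T (onb H p.1)⟫_ℂ‖ ^ 2
  have hf : Summable f := by
    refine (summable_prod_of_nonneg fun p => by positivity).2
      ⟨fun i => (hasSum_sq_inner_onb (T (onb H i))).summable, h.summable.congr fun i => ?_⟩
    exact (hasSum_sq_inner_onb (T (onb H i))).tsum_eq.symm
  have h1 : HasSum f s := by
    have := hf.hasSum.prod_fiberwise fun i => hasSum_sq_inner_onb (T (onb H i))
    rw [h.unique this]
    exact hf.hasSum
  have h2 : HasSum (fun p : basisIndex H × basisIndex H => f p.swap) s :=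
    (Equiv.prodComm _ _).hasSum_iff.2 h1
  refine h2.prod_fiberwise fun i => ?_
  have e : ∀ j, f (i, j).swap = ‖⟪onb H j, (star T) (onb H i)⟫_ℂ‖ ^ 2 := fun j => by
    change ‖⟪onb H i, T (onb H j)⟫_ℂ‖ ^ 2 = _
    rw [ContinuousLinearMap.star_eq_adjoint, ContinuousLinearMap.adjoint_inner_right,
      norm_inner_symm]
  simp only [e]
  exact hasSum_sq_inner_onb _

lemma HS.hasSum_norm_sq (T : HS H) : HasSum (fun i => ‖T.op (onb H i)‖ ^ 2) (‖T‖ ^ 2) := by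
  have hs : Summable (fun i => ‖T.op (onb H i)‖ ^ 2) := T.2
  have e : ((‖T‖ ^ 2 : ℝ) : ℂ) = ∑' i, ((‖T.op (onb H i)‖ ^ 2 : ℝ) : ℂ) := by
    have h := inner_self_eq_norm_sq_to_K (𝕜 := ℂ) T
    rw [Complex.ofReal_pow]
    refine h.symm.trans (tsum_congr fun i => ?_)
    rw [inner_self_eq_norm_sq_to_K]
    norm_cast
  rw [← Complex.ofReal_tsum, Complex.ofReal_inj] at e
  rw [e]
  exact hs.hasSum

/-- The adjoint of Hilbert-Schmidt operators, a real linear isometry. -/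
def HS.adj : HS H →ₗᵢ[ℝ] HS H where
  toFun T := ⟨star T.op, (hasSum_star_sq T.hasSum_norm_sq).summable⟩
  map_add' S T := HS.op_injective (star_add S.op T.op)
  map_smul' c T := HS.op_injective (by
    change star (((c : ℂ) • T : HS H).op) = (c : ℂ) • star T.op
    rw [map_smul, star_smul]
    simp)
  norm_map' T := by
    have h := (HS.hasSum_norm_sq (⟨star T.op, (hasSum_star_sq T.hasSum_norm_sq).summable⟩ : HS H))
    have := h.unique (hasSum_star_sq T.hasSum_norm_sq)
    exact (sq_eq_sq₀ (norm_nonneg _) (norm_nonneg _)).1 this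

@[simp] lemma HS.op_adj (T : HS H) : T.adj.op = star T.op := rfl

lemma adj_mem_T0 {T : HS H} (h : T ∈ T0 H) : T.adj ∈ T0 H :=
  ⟨h.1.star, by rw [HS.op_adj, opTrace_star, h.2, map_zero]⟩

lemma adj_mem_XiC {T : HS H} (h : T ∈ XiC H) : T.adj ∈ XiC H :=
  map_mem_closure (s := (T0 H : Set (HS H))) (t := (T0 H : Set (HS H))) HS.adj.continuous h
    fun _ hT => adj_mem_T0 hT

/-- The continuous map S ↦ (S + S*)/2 fixes T and sends `T0` into `T0sa`, hence closure into
closure. -/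
lemma mem_XiR_of_isSelfAdjoint {T : HS H} (h : T ∈ XiC H) (hT : IsSelfAdjoint T.op) :
    T ∈ XiR H := by
  have e : T = (1 / 2 : ℝ) • (T + T.adj) := by
    have : T.adj = T := HS.op_injective hT
    rw [this, ← two_smul ℝ T, smul_smul]
    norm_num
  rw [e]
  refine map_mem_closure (s := (T0 H : Set (HS H))) (t := (T0sa H : Set (HS H)))
    (f := fun S : HS H => (1 / 2 : ℝ) • (S + S.adj))
    ((continuous_id.add HS.adj.continuous).const_smul (1 / 2 : ℝ)) h fun S hS => ?_
  have e' : (1 / 2 : ℝ) • (S + S.adj) = ((1 / 2 : ℝ) : ℂ) • (S + S.adj) := rfl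
  refine ⟨?_, ?_⟩
  · change (1 / 2 : ℝ) • (S + S.adj) ∈ T0 H
    rw [e']
    exact (T0 H).smul_mem _ (add_mem hS (adj_mem_T0 hS))
  · change IsSelfAdjoint ((1 / 2 : ℝ) • (S + S.adj)).op
    rw [e', map_smul, map_add, HS.op_adj]
    exact IsSelfAdjoint.smul (by simp [IsSelfAdjoint]) (IsSelfAdjoint.add_star_self _)

lemma T0sa_le_T0 {T : HS H} (h : T ∈ T0sa H) : T ∈ T0 H := h.1

lemma XiR_le_XiC {T : HS H} (h : T ∈ XiR H) : T ∈ XiC H :=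
  closure_mono (s := (T0sa H : Set (HS H))) (t := (T0 H : Set (HS H))) (fun _ => T0sa_le_T0) h

lemma isSelfAdjoint_of_mem_XiR {T : HS H} (h : T ∈ XiR H) : IsSelfAdjoint T.op := by
  have hc : IsClosed {S : HS H | S.adj = S} := isClosed_eq HS.adj.continuous continuous_id
  have : T.adj = T := closure_minimal (s := (T0sa H : Set (HS H)))
    (fun S hS => HS.op_injective (IsSelfAdjoint.star_eq hS.2)) hc h
  exact congrArg HS.op this

/-- A multiple of the identity in the closure of the trace zero operators vanishes. -/
lemma eq_zero_of_mem_XiC_of_op_eq_smul_one {ψ : HS H} (hψ : ψ ∈ XiC H) {c : ℂ}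
    (h : ψ.op = c • 1) : ψ = 0 := by
  -- A multiple of the identity is orthogonal to every trace-zero operator, hence to their closure,
  -- which contains ψ itself.
  have hc : IsClosed {S : HS H | ⟪ψ, S⟫_ℂ = 0} :=
    isClosed_eq (continuous_const.inner continuous_id) continuous_const
  have : ⟪ψ, ψ⟫_ℂ = 0 := closure_minimal (s := (T0 H : Set (HS H))) (fun S hS => by
    change ⟪ψ, S⟫_ℂ = 0
    rw [HS.inner_eq_opTrace, h, star_smul, star_one, smul_mul_assoc, one_mul, opTrace_smul,
      hS.2, mul_zero]) hc hψ
  exact inner_self_eq_zero.1 this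

/-! ### Graphs of partially defined operators -/

/-- `Submodule.toLinearPMap` has the submodule as its graph only when that submodule is
single-valued. This is why the graphs below need the `functional` lemmas. -/
lemma toLinearPMap_apply_eq {R E F : Type*} [Ring R] [AddCommGroup E] [AddCommGroup F]
    [Module R E] [Module R F] {g : Submodule R (E × F)}
    (hg : ∀ p ∈ g, p.1 = 0 → p.2 = 0) {x : E} {y : F} (h : (x, y) ∈ g) :
    ∃ hx : x ∈ g.toLinearPMap.domain, g.toLinearPMap ⟨x, hx⟩ = y := by
  refine ⟨⟨(x, y), h, rfl⟩, ?_⟩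
  have h1 := g.mem_graph_toLinearPMap hg ⟨x, ⟨(x, y), h, rfl⟩⟩
  have := hg _ (g.sub_mem h1 h) (by simp)
  exact sub_eq_zero.1 this

/-- `J⁺ y = x` if `J x = y` and `J` is injective. -/
lemma moorePenrose_apply_eq {𝕜 E : Type*} [RCLike 𝕜] [NormedAddCommGroup E]
    [InnerProductSpace 𝕜 E] {g : Submodule 𝕜 (E × E)} (hg : ∀ p ∈ g, p.1 = 0 → p.2 = 0)
    (hker : ∀ p ∈ g, p.2 = 0 → p.1 = 0) {x y : E} (h : (x, y) ∈ g) :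
    ∃ hy : y ∈ (moorePenrose g.toLinearPMap).domain,
      moorePenrose g.toLinearPMap ⟨y, hy⟩ = x := by
  obtain ⟨hx, hxy⟩ := toLinearPMap_apply_eq hg h
  refine toLinearPMap_apply_eq (moorePenroseGraph_functional _) ⟨hx, ?_, ?_⟩
  -- Injectivity makes the condition x ∈ (ker J)ᗮ vacuous; the residual y - Jx is zero.
  · have : pker g.toLinearPMap = ⊥ := by
      rw [eq_bot_iff]
      rintro _ ⟨z, hz, rfl⟩
      exact hker _ (g.mem_graph_toLinearPMap hg z) hz
    rw [this]
    simp
  · change y - g.toLinearPMap ⟨x, hx⟩ ∈ _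
    rw [hxy, sub_self]
    exact zero_mem _

/-! ### Fisher information operators at strictly positive states -/

/-- If χ = 0 then L = 0, so ψ is orthogonal to every ρX of trace zero. This forces ψ*ρ = cρ, so ψ is
a multiple of the identity and vanishes in Ξ̃. -/
lemma fisherGraphC_KR_functional {ρ : DensityOperator H} (hρ : IsStrictlyPos ρ.op)
    (p : XiC H × XiC H) (hp : p ∈ fisherGraphC (KR ρ.op)) (h0 : p.1 = 0) : p.2 = 0 := by
  obtain ⟨-, L, hL, h⟩ := hp
  have hL0 : L = 0 := hρ.eq_zero_of_mul_left (by
    have : KR ρ.op L = _ := hL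
    rw [h0] at this
    simpa [KR_apply] using this)
  subst hL0
  have ht := ρ.isTraceClass
  obtain ⟨c, hc⟩ := eq_smul_of_opTrace_mul_eq_zero (T := star (p.2 : HS H).op * ρ.op)
    ht hρ.isSelfAdjoint (by simp [ρ.opTrace_eq_one]) (ht.mul_left _) fun X hX hX0 => by
      have hφ : IsTraceClass (ρ.op * X) := ht.mul_right X
      have := h (HS.ofTraceClass _ hφ)
        ⟨hφ, by rw [HS.op_ofTraceClass, opTrace_mul_comm ht, hX0]⟩ X rfl
      rw [mul_zero, opTrace_zero, ← inner_conj_symm, map_eq_zero, HS.inner_eq_opTrace,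
        HS.op_ofTraceClass, ← mul_assoc, opTrace_mul_comm (ht.mul_left _)] at this
      exact this
  have h1 : (star (p.2 : HS H).op - c • 1) * ρ.op = 0 := by
    rw [sub_mul, smul_mul_assoc, one_mul, hc, sub_self]
  have h2 := congrArg star (sub_eq_zero.1 (hρ.eq_zero_of_mul_right h1))
  rw [star_star, star_smul, star_one] at h2
  exact Subtype.ext (eq_zero_of_mem_XiC_of_op_eq_smul_one p.2.2 h2)

/-- Testing Jχ = 0 against χ itself gives Tr[L*ρL] = 0, hence L = 0 and χ = ρL = 0. -/
lemma fisherGraphC_KR_injective {ρ : DensityOperator H} (hρ : IsStrictlyPos ρ.op)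
    (p : XiC H × XiC H) (hp : p ∈ fisherGraphC (KR ρ.op)) (h0 : p.2 = 0) : p.1 = 0 := by
  obtain ⟨hT, L, hL, h⟩ := hp
  have h1 := h p.1 hT L hL
  rw [h0, Submodule.coe_zero, inner_zero_right, KR_apply, star_mul,
    hρ.isSelfAdjoint.star_eq] at h1
  have hL0 : L = 0 := hρ.eq_zero_of_opTrace ρ.isTraceClass (by rw [← h1, Complex.zero_re])
  refine Subtype.ext (HS.op_injective ?_)
  have : KR ρ.op L = _ := hL
  rw [hL0, map_zero] at this
  exact this.symm

lemma fisherGraphR_KS_functional {ρ : DensityOperator H} (hρ : IsStrictlyPos ρ.op)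
    (p : XiR H × XiR H) (hp : p ∈ fisherGraphR (KS ρ.op)) (h0 : p.1 = 0) : p.2 = 0 := by
  obtain ⟨-, L, hL, h⟩ := hp
  have ht := ρ.isTraceClass
  have hL0 : L = 0 := hρ.eq_zero_of_KS ht (by
    have : KS ρ.op L = _ := hL
    rw [h0] at this
    simpa using this)
  subst hL0
  have htK : ∀ X, IsTraceClass (KS ρ.op X) := fun X =>
    ((ht.mul_right X).add (ht.mul_left X)).smul _
  -- K^S is symmetric for the trace pairing, so it can be moved from the test operator X onto ψ.
  have hpair : ∀ X Y : H →L[ℂ] H, opTrace (KS ρ.op X * Y) = opTrace (X * KS ρ.op Y) := by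
    intro X Y
    rw [KS_apply, KS_apply, smul_mul_assoc, mul_smul_comm, opTrace_smul, opTrace_smul, add_mul,
      mul_add, opTrace_add ((ht.mul_right X).mul_right Y) ((ht.mul_left X).mul_right Y),
      opTrace_add ((ht.mul_right Y).mul_left X) ((ht.mul_left Y).mul_left X),
      add_comm, mul_assoc, mul_assoc, opTrace_mul_comm ht, mul_assoc]
  -- Only self-adjoint X are used, so that the test direction K^S X lies in `T0sa`. The outcome K^S
  -- ψ = cρ = K^S(c·1) then yields ψ = c·1.
  obtain ⟨c, hc⟩ := eq_smul_of_opTrace_mul_eq_zero (T := KS ρ.op (p.2 : HS H).op)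
    ht hρ.isSelfAdjoint (by simp [ρ.opTrace_eq_one]) (htK _) fun X hX hX0 => by
      have hsa : IsSelfAdjoint (KS ρ.op X) := by
        rw [IsSelfAdjoint, KS_apply, star_smul, star_add, star_mul, star_mul, hX.star_eq,
          hρ.isSelfAdjoint.star_eq, add_comm]
        simp
      have htr : opTrace (KS ρ.op X) = 0 := by
        rw [KS_apply, opTrace_smul, opTrace_add (ht.mul_right X) (ht.mul_left X),
          opTrace_mul_comm ht, hX0]
        simp
      have := h (HS.ofTraceClass _ (htK X)) ⟨⟨htK X, htr⟩, hsa⟩ X rfl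
      rw [mul_zero, opTrace_zero, HS.inner_eq_opTrace, HS.op_ofTraceClass, hsa.star_eq,
        hpair] at this
      exact this
  have h1 : KS ρ.op ((p.2 : HS H).op - c • 1) = 0 := by
    have h2 : KS ρ.op 1 = ρ.op := by
      rw [KS_apply, mul_one, one_mul, ← two_smul ℂ ρ.op, smul_smul]
      norm_num
    rw [map_sub, hc, map_smul, h2, sub_self]
  exact Subtype.ext (eq_zero_of_mem_XiC_of_op_eq_smul_one (XiR_le_XiC p.2.2)
    (sub_eq_zero.1 (hρ.eq_zero_of_KS ht h1)))

lemma fisherGraphR_KS_injective {ρ : DensityOperator H} (hρ : IsStrictlyPos ρ.op)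
    (p : XiR H × XiR H) (hp : p ∈ fisherGraphR (KS ρ.op)) (h0 : p.2 = 0) : p.1 = 0 := by
  obtain ⟨hT, L, hL, h⟩ := hp
  have h1 := h p.1 hT L hL
  rw [h0, Submodule.coe_zero, inner_zero_right] at h1
  have hL0 : L = 0 := hρ.eq_zero_of_opTrace_KS ρ.isTraceClass h1.symm
  refine Subtype.ext (HS.op_injective ?_)
  have : KS ρ.op L = _ := hL
  rw [hL0, map_zero] at this
  exact this.symm

/-- `J^R χ = a` for `χ = ρ (a + c)` of trace zero. -/
lemma mem_fisherGraphC_KR {ρ : DensityOperator H} {χ a : XiC H} {c : ℂ}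
    (hχ : (χ : HS H) ∈ T0 H) (h : (χ : HS H).op = KR ρ.op ((a : HS H).op + c • 1)) :
    (χ, a) ∈ fisherGraphC (KR ρ.op) := by
  refine ⟨hχ, _, h.symm, fun φ hφ X hX => ?_⟩
  -- The constant c contributes c Tr[φ*] = 0, so L = a + c pairs with φ as a does.
  have hX' : KR ρ.op X = φ.op := hX
  rw [hX', HS.inner_eq_opTrace, mul_add, opTrace_add (hφ.1.star.mul_right _)
    (hφ.1.star.mul_right _), mul_smul_comm, opTrace_smul, mul_one, opTrace_star, hφ.2]
  simp

/-- `J^S χ = a` for `χ = (ρ (a + c) + (a + c) ρ) / 2` of trace zero. -/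
lemma mem_fisherGraphR_KS {ρ : DensityOperator H} {χ a : XiR H} {c : ℂ}
    (hχ : (χ : HS H) ∈ T0sa H) (h : (χ : HS H).op = KS ρ.op ((a : HS H).op + c • 1)) :
    (χ, a) ∈ fisherGraphR (KS ρ.op) := by
  refine ⟨hχ, _, h.symm, fun φ hφ X hX => ?_⟩
  have hX' : KS ρ.op X = φ.op := hX
  rw [hX', HS.inner_eq_opTrace, mul_add, opTrace_add (hφ.1.1.star.mul_right _)
    (hφ.1.1.star.mul_right _), mul_smul_comm, opTrace_smul, mul_one, opTrace_star, hφ.1.2]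
  simp

/-! ### Expectations -/

/-- Density of dom A makes the bounded extension of ρA unique, so the one chosen in `expect` is T.
-/
lemma expect_eq {ρ : H →L[ℂ] H} {A : H →ₗ.[ℂ] H} {T : H →L[ℂ] H}
    (hA : Dense (A.domain : Set H)) (hT : IsTraceClassProd ρ A T) :
    expect ρ A = opTrace T := by
  have h : ∃ T, IsTraceClassProd ρ A T := ⟨T, hT⟩
  rw [expect, dif_pos h]
  have e : (h.choose : H → H) = T :=
    h.choose.continuous.ext_on hA T.continuous fun x hx =>
      (h.choose_spec.2 ⟨x, hx⟩).trans (hT.2 ⟨x, hx⟩).symm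
  rw [DFunLike.coe_injective e]

lemma expect_eq_of_bounded {ρ : H →L[ℂ] H} {A : H →ₗ.[ℂ] H} {A' : H →L[ℂ] H}
    (hρ : IsTraceClass ρ) (hA : Dense (A.domain : Set H)) (h : ∀ x : A.domain, A x = A' x) :
    expect ρ A = opTrace (ρ * A') :=
  expect_eq hA ⟨hρ.mul_right _, fun x => by rw [h, mul_apply_eq_comp]⟩

/-- If `⟨A⟩` has a gradient `a` at a strictly positive state then `A` is the restriction of
a bounded operator `a* + c`. -/
lemma IsGradient.exists_eq {ρ₀ : DensityOperator H} {θ : paramSet ρ₀} {A : H →ₗ.[ℂ] H}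
    {a : XiC H} (hA : A ∈ finiteExp (stateAt ρ₀ θ).op) (ha : IsGradient ρ₀ θ A a) :
    ∃ c : ℂ, ∀ x : A.domain, A x = (star (a : HS H).op + c • 1) x := by
  set ρ := (stateAt ρ₀ θ).op with hρdef
  have hρ : IsStrictlyPos ρ := θ.2.2
  have ht : IsTraceClass ρ := (stateAt ρ₀ θ).isTraceClass
  obtain ⟨hd, T, hT⟩ := hA
  have key : ∀ X : H →L[ℂ] H, IsSelfAdjoint X → opTrace (X * (ρ * ρ)) = 0 →
      opTrace (X * (T * ρ - ρ * star (a : HS H).op * ρ)) = 0 := by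
    intro X hX hX0
    -- The right factor ρ keeps φA = ρX(ρA) trace class although A may be unbounded; both factors
    -- together make φ small relative to ρ.
    have hφt : IsTraceClass (ρ * X * ρ) := ht.mul_left _
    set φ : HS H := HS.ofTraceClass _ hφt with hφdef
    have hφ : φ ∈ T0sa H := by
      refine ⟨⟨hφt, ?_⟩, ?_⟩
      · rw [HS.op_ofTraceClass, mul_assoc, opTrace_mul_comm ht, mul_assoc, hX0]
      · simp [IsSelfAdjoint, φ, star_mul, hρ.isSelfAdjoint.star_eq, hX.star_eq, mul_assoc]
    have hop : ∀ t : ℝ, ρ₀.op + (θ.1 + (t : ℂ) • φ).op = ρ + (t : ℂ) • (ρ * X * ρ) := fun t => by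
      rw [map_add, map_smul, ← add_assoc]
      rfl
    have hfin : ∀ t : ℝ, IsTraceClassProd (ρ₀.op + (θ.1 + (t : ℂ) • φ).op) A
        (T + (t : ℂ) • (ρ * X * T)) := fun t => by
      refine ⟨hT.1.add ((hT.1.mul_left _).smul _), fun x => ?_⟩
      rw [hop]
      simp [hT.2 x]
    have htend : Filter.Tendsto (fun t : ℝ => θ.1 + (t : ℂ) • φ) (𝓝 0)
        (𝓝[{θ' | θ' ∈ paramSet ρ₀ ∧ A ∈ finiteExp (ρ₀.op + θ'.op)}] θ.1) := by
      refine tendsto_nhdsWithin_iff.2 ⟨?_, ?_⟩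
      · have : Continuous (fun t : ℝ => θ.1 + (t : ℂ) • φ) := by fun_prop
        simpa using this.tendsto 0
      · filter_upwards [hρ.eventually_add hX] with t h
        refine ⟨⟨(T0sa H).add_mem θ.2.1 ((T0sa H).smul_mem t hφ), ?_⟩, hd, _, hfin t⟩
        rw [hop]
        exact h
    have ho := ha.comp_tendsto htend
    -- The expectation is affine in t, so the gradient's error term is exactly tk. Being o(t), it
    -- forces k = 0.
    set k : ℂ := opTrace (ρ * X * T) - ⟪(a : HS H), φ⟫_ℂ with hk
    have hk' : (fun t : ℝ => (t : ℂ) * k) =o[𝓝 0] (fun t : ℝ => (t : ℂ) • φ) := by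
      refine ho.congr (fun t => ?_) (fun t => ?_)
      · have e0 := hfin 0
        simp only [Complex.ofReal_zero, zero_smul, add_zero] at e0
        simp only [Function.comp]
        rw [expect_eq hd (hfin t), expect_eq hd e0,
          opTrace_add hT.1 ((hT.1.mul_left _).smul _), opTrace_smul, add_sub_cancel_left,
          add_sub_cancel_left, inner_smul_right, hk]
        ring
      · simp
    have hk0 : k = 0 := by
      have h1 : (fun t : ℝ => (t : ℂ) • φ) =O[𝓝 0] (fun t : ℝ => t) :=
        Asymptotics.IsBigO.of_bound ‖φ‖ (.of_forall fun t => by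
          rw [norm_smul, mul_comm, Complex.norm_real])
      have h2 := hk'.trans_isBigO h1
      rw [Asymptotics.isLittleO_iff] at h2
      by_contra hne
      have hpos : 0 < ‖k‖ := norm_pos_iff.2 hne
      have h3 := h2 (half_pos hpos)
      obtain ⟨ε, hε, h4⟩ := Metric.eventually_nhds_iff.1 h3
      have h5 := h4 (y := ε / 2) (by
        rw [Real.dist_eq, sub_zero, abs_of_pos (by linarith)]; linarith)
      rw [norm_mul, Complex.norm_real, mul_comm] at h5
      have : 0 < ‖ε / 2‖ := norm_pos_iff.2 (by linarith)
      nlinarith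
    have e1 : opTrace (ρ * X * T) = opTrace (X * (T * ρ)) := by
      rw [mul_assoc, opTrace_mul_comm ht, mul_assoc]
    have e2 : ⟪(a : HS H), φ⟫_ℂ = opTrace (X * (ρ * star (a : HS H).op * ρ)) := by
      rw [HS.inner_eq_opTrace, hφdef, HS.op_ofTraceClass,
        show star (a : HS H).op * (ρ * X * ρ) = (star (a : HS H).op * ρ) * (X * ρ) by
          simp only [mul_assoc], opTrace_mul_comm (ht.mul_left _), mul_assoc,
        ← mul_assoc ρ]
    rw [mul_sub, opTrace_sub ((hT.1.mul_right _).mul_left _) ((ht.mul_left _).mul_left _), ← e1,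
      ← e2]
    exact hk0
  have hρ0 : opTrace (ρ * ρ) ≠ 0 := fun h => by
    have h0 : ρ = 0 := eq_zero_of_opTrace_star_mul_self ht (by
      rw [hρ.isSelfAdjoint.star_eq, h])
    have h1 : opTrace ρ = 1 := (stateAt ρ₀ θ).opTrace_eq_one
    rw [h0, opTrace_zero] at h1
    exact zero_ne_one h1
  obtain ⟨c, hc⟩ := eq_smul_of_opTrace_mul_eq_zero (ht.mul_right ρ)
    (by simp [IsSelfAdjoint, star_mul, hρ.isSelfAdjoint.star_eq]) hρ0
    ((hT.1.mul_right ρ).sub (ht.mul_left _)) key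
  -- Cancelling ρ on the right identifies T; cancelling it on the left then identifies A on its
  -- domain.
  have h1 : (T - ρ * (star (a : HS H).op + c • 1)) * ρ = 0 := by
    have e : (T - ρ * (star (a : HS H).op + c • 1)) * ρ
        = T * ρ - ρ * star (a : HS H).op * ρ - c • (ρ * ρ) := by
      simp only [mul_add, sub_mul, add_mul, mul_smul_comm, mul_one, smul_mul_assoc]
      abel
    rw [e, hc, sub_self]
  have h2 : T = ρ * (star (a : HS H).op + c • 1) := sub_eq_zero.1 (hρ.eq_zero_of_mul_right h1)
  refine ⟨c, fun x => sub_eq_zero.1 (hρ.eq_zero_of_apply ?_)⟩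
  rw [map_sub, ← hT.2 x, h2, mul_apply_eq_comp, sub_self]

/-! ### Operators with bounded extension -/

lemma adjoint_of_bounded {A : H →ₗ.[ℂ] H} {A' : H →L[ℂ] H} (hA : Dense (A.domain : Set H))
    (h : ∀ x : A.domain, A x = A' x) (y : H) :
    ∃ hy : y ∈ A.adjoint.domain, A.adjoint ⟨y, hy⟩ = star A' y := by
  have e : ∀ x : A.domain, ⟪star A' y, (x : H)⟫_ℂ = ⟪y, A x⟫_ℂ := fun x => by
    rw [h, ContinuousLinearMap.star_eq_adjoint, ContinuousLinearMap.adjoint_inner_left]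
  have hy := A.mem_adjoint_domain_of_exists y ⟨_, e⟩
  exact ⟨hy, A.adjoint_apply_eq hA ⟨y, hy⟩ e⟩

lemma pmul_adjoint_apply {A B : H →ₗ.[ℂ] H} {A' B' : H →L[ℂ] H}
    (hA : Dense (A.domain : Set H)) (hA' : ∀ x : A.domain, A x = A' x)
    (hB' : ∀ x : B.domain, B x = B' x) (x : (pmul A.adjoint B).domain) :
    pmul A.adjoint B x = (star A' * B') x := by
  obtain ⟨x, hx⟩ := x
  obtain ⟨z, -, hz⟩ := hx.1
  obtain ⟨hy, e⟩ := adjoint_of_bounded hA hA' (B z)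
  have hzx : (z : H) = x := hz
  subst hzx
  have : pmul A.adjoint B ⟨z, hx⟩ = A.adjoint ⟨B z, hy⟩ := rfl
  rw [this, e, hB', mul_apply_eq_comp]

/-- The adjoint of a densely defined restriction of a bounded operator is defined everywhere, so the
product loses no domain. -/
lemma pmul_adjoint_domain {A B : H →ₗ.[ℂ] H} {A' : H →L[ℂ] H}
    (hA : Dense (A.domain : Set H)) (hA' : ∀ x : A.domain, A x = A' x) :
    (pmul A.adjoint B).domain = B.domain := by
  refine le_antisymm (fun x hx => hx.2) fun x hx => ⟨⟨⟨x, hx⟩, ?_, rfl⟩, hx⟩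
  exact (adjoint_of_bounded hA hA' _).1

/-! ### Covariances as traces and through the Moore-Penrose inverses -/

lemma cov_eq {ρ : DensityOperator H} {A B : H →ₗ.[ℂ] H} {A' B' : H →L[ℂ] H}
    (hρ : IsSelfAdjoint ρ.op)
    (hA : Dense (A.domain : Set H)) (hA' : ∀ x : A.domain, A x = A' x)
    (hB : Dense (B.domain : Set H)) (hB' : ∀ x : B.domain, B x = B' x) :
    cov ρ.op A B = opTrace (ρ.op * star A' * B')
      - opTrace (ρ.op * star A') * opTrace (ρ.op * B') := by
  have ht := ρ.isTraceClass
  rw [cov, expect_eq_of_bounded ht hA hA', expect_eq_of_bounded ht hB hB',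
    expect_eq_of_bounded ht (by rwa [pmul_adjoint_domain hA hA'])
      (pmul_adjoint_apply hA hA' hB'), ← opTrace_star, star_mul, hρ.star_eq,
    ← opTrace_mul_comm ht (star A'), mul_assoc]

/-- The centered operator `a - Tr[ρ a]`. -/
def centered (ρ a : H →L[ℂ] H) : H →L[ℂ] H := a + (-opTrace (ρ * a)) • 1

lemma opTrace_mul_centered (ρ : DensityOperator H) (a : H →L[ℂ] H) :
    opTrace (ρ.op * centered ρ.op a) = 0 := by
  rw [centered, mul_add, mul_smul_comm, mul_one, opTrace_add (ρ.isTraceClass.mul_right _)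
    (ρ.isTraceClass.smul _), opTrace_smul, ρ.opTrace_eq_one]
  ring

/-- Covariances ignore the constants c and d because Tr ρ = 1. What remains is Tr[ρab*] -
Tr[ρa]Tr[ρb*], with the second term absorbed into the centering of a. -/
lemma cov_eq_opTrace_centered {ρ : DensityOperator H} {A B : H →ₗ.[ℂ] H} {a b : H →L[ℂ] H}
    {c d : ℂ} (hρ : IsSelfAdjoint ρ.op)
    (hA : Dense (A.domain : Set H)) (hA' : ∀ x : A.domain, A x = (star a + c • 1) x)
    (hB : Dense (B.domain : Set H)) (hB' : ∀ x : B.domain, B x = (star b + d • 1) x) :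
    cov ρ.op A B = opTrace (ρ.op * centered ρ.op a * star b) := by
  have ht := ρ.isTraceClass
  rw [cov_eq hρ hA hA' hB hB', centered]
  simp only [star_add, star_star, star_smul, star_one, mul_add, add_mul, mul_smul_comm,
    smul_mul_assoc, mul_one]
  have t1 : IsTraceClass (ρ.op * a) := ht.mul_right _
  have t2 : IsTraceClass (ρ.op * star b) := ht.mul_right _
  have t3 : IsTraceClass (ρ.op * a * star b) := t1.mul_right _
  rw [opTrace_add (t3.add (t2.smul _)) ((t1.add (ht.smul _)).smul _), opTrace_add t3 (t2.smul _),
    opTrace_smul, opTrace_smul, opTrace_add t1 (ht.smul _), opTrace_add t2 (ht.smul _),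
    opTrace_add t3 (t2.smul _), opTrace_smul, opTrace_smul, opTrace_smul, ρ.opTrace_eq_one]
  ring

/-- The adjoint of A is everywhere defined and equals A'*; since it is A, it also agrees with A'. -/
lemma isSelfAdjoint_of_bounded {A : H →ₗ.[ℂ] H} {A' : H →L[ℂ] H} (hA : IsSelfAdjoint A)
    (h : ∀ x : A.domain, A x = A' x) : IsSelfAdjoint A' := by
  have e : A.adjoint = A := LinearPMap.isSelfAdjoint_def.1 hA
  ext y
  have := adjoint_of_bounded hA.dense_domain h y
  rw [e] at this
  obtain ⟨hy, h1⟩ := this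
  rw [← h1, h]

lemma isSelfAdjoint_of_isSelfAdjoint_star_add {a : HS H} (ha : a ∈ XiC H) {c : ℂ}
    (h : IsSelfAdjoint (star a.op + c • 1)) : IsSelfAdjoint a.op := by
  have h1 : a - a.adj = 0 := by
    -- Self-adjointness of a* + c says a - a* = c - c̄, a multiple of the identity lying in Ξ̃.
    refine eq_zero_of_mem_XiC_of_op_eq_smul_one (sub_mem ha (adj_mem_XiC ha)) (c := c - star c) ?_
    have h2 := h.star_eq
    rw [star_add, star_star, star_smul, star_one] at h2
    rw [map_sub, HS.op_adj, sub_smul, sub_eq_sub_iff_add_eq_add, h2, add_comm]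
  exact (congrArg HS.op (sub_eq_zero.1 h1)).symm

/-- Covariances through the Moore-Penrose inverse of the RLD Fisher information. -/
lemma cov_eq_inner_moorePenrose {ρ : DensityOperator H} (hρ : IsStrictlyPos ρ.op)
    {A B : H →ₗ.[ℂ] H} {a b : XiC H} {c d : ℂ}
    (hA : Dense (A.domain : Set H))
    (hA' : ∀ x : A.domain, A x = (star (a : HS H).op + c • 1) x)
    (hB : Dense (B.domain : Set H))
    (hB' : ∀ x : B.domain, B x = (star (b : HS H).op + d • 1) x) :
    ∃ h : a ∈ (moorePenrose (fisherR ρ)).domain,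
      cov ρ.op A B = ⟪b, moorePenrose (fisherR ρ) ⟨a, h⟩⟫_ℂ := by
  -- Centering is the choice of constant that makes χ = ρL a trace-zero direction with J^R χ = a.
  set L := centered ρ.op (a : HS H).op with hL
  have ht : IsTraceClass (ρ.op * L) := ρ.isTraceClass.mul_right L
  have hχ : HS.ofTraceClass _ ht ∈ T0 H := ⟨ht, opTrace_mul_centered ρ _⟩
  obtain ⟨h, e⟩ := moorePenrose_apply_eq (fisherGraphC_KR_functional hρ)
    (fisherGraphC_KR_injective hρ)
    (mem_fisherGraphC_KR (χ := ⟨_, (T0 H).le_topologicalClosure hχ⟩) (a := a) hχ rfl)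
  refine ⟨h, ?_⟩
  rw [cov_eq_opTrace_centered hρ.isSelfAdjoint hA hA' hB hB', ← hL]
  have e' : moorePenrose (fisherR ρ) ⟨a, h⟩ = _ := e
  rw [e', Submodule.coe_inner, HS.inner_eq_opTrace, HS.op_ofTraceClass, opTrace_mul_comm ht]

/-- Symmetrized covariances through the Moore-Penrose inverse of the SLD Fisher information. -/
lemma symCov_eq_inner_moorePenrose {ρ : DensityOperator H} (hρ : IsStrictlyPos ρ.op)
    {A B : H →ₗ.[ℂ] H} {a b : XiR H} {c d : ℂ}
    (hA : Dense (A.domain : Set H))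
    (hA' : ∀ x : A.domain, A x = (star (a : HS H).op + c • 1) x)
    (hB : Dense (B.domain : Set H))
    (hB' : ∀ x : B.domain, B x = (star (b : HS H).op + d • 1) x) :
    ∃ h : a ∈ (moorePenrose (fisherS ρ)).domain,
      symCov ρ.op A B = ((⟪b, moorePenrose (fisherS ρ) ⟨a, h⟩⟫_ℝ : ℝ) : ℂ) := by
  have ht := ρ.isTraceClass
  have ha := isSelfAdjoint_of_mem_XiR a.2
  have hb := isSelfAdjoint_of_mem_XiR b.2
  set L := centered ρ.op (a : HS H).op with hL
  set N := centered ρ.op (b : HS H).op with hN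
  have hLs : IsSelfAdjoint L := by
    refine ha.add (IsSelfAdjoint.smul ?_ (.one _))
    rw [IsSelfAdjoint, ← starRingEnd_apply, map_neg, ← opTrace_star, star_mul, ha.star_eq,
      hρ.isSelfAdjoint.star_eq, opTrace_mul_comm ht]
  have htK : IsTraceClass (KS ρ.op L) := ((ht.mul_right L).add (ht.mul_left L)).smul _
  have hKs : IsSelfAdjoint (KS ρ.op L) := by
    rw [IsSelfAdjoint, KS_apply, star_smul, star_add, star_mul, star_mul, hLs.star_eq,
      hρ.isSelfAdjoint.star_eq, add_comm]
    simp
  have hL0 : opTrace (ρ.op * L) = 0 := opTrace_mul_centered ρ _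
  have hN0 : opTrace (ρ.op * N) = 0 := opTrace_mul_centered ρ _
  have hχ : HS.ofTraceClass _ htK ∈ T0sa H := by
    refine ⟨⟨htK, ?_⟩, hKs⟩
    rw [HS.op_ofTraceClass, KS_apply, opTrace_smul, opTrace_add (ht.mul_right L) (ht.mul_left L),
      ← opTrace_mul_comm ht, hL0]
    simp
  obtain ⟨h, e⟩ := moorePenrose_apply_eq (fisherGraphR_KS_functional hρ)
    (fisherGraphR_KS_injective hρ)
    (mem_fisherGraphR_KS (χ := ⟨_, (T0sa H).le_topologicalClosure hχ⟩) (a := a) hχ rfl)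
  refine ⟨h, ?_⟩
  have e' : moorePenrose (fisherS ρ) ⟨a, h⟩ = _ := e
  rw [e', Submodule.coe_inner]
  set χ := HS.ofTraceClass _ htK with hχdef
  -- The real inner product is the real part of Tr[bχ], which is already real since b and χ are
  -- self-adjoint.
  have hreal : ((⟪(b : HS H), χ⟫_ℝ : ℝ) : ℂ) = ⟪(b : HS H), χ⟫_ℂ := by
    refine Complex.conj_eq_iff_re.1 ?_
    rw [inner_conj_symm, HS.inner_eq_opTrace, HS.inner_eq_opTrace, hb.star_eq, hχdef,
      HS.op_ofTraceClass, hKs.star_eq, opTrace_mul_comm htK]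
  -- The formula for C(B, A) centers b rather than a. Because Tr[ρN] = Tr[ρL] = 0, the centering
  -- moves over to a at no cost: C(B, A) = Tr[Lρb]. Its mean with C(A, B) = Tr[ρLb] is Tr[(K^S L)
  -- b].
  have h1 : opTrace (ρ.op * N * (a : HS H).op) = opTrace (ρ.op * N * L) := by
    rw [hL, centered, mul_add (ρ.op * N), mul_smul_comm, mul_one,
      opTrace_add ((ht.mul_right N).mul_right _) ((ht.mul_right N).smul _), opTrace_smul, hN0,
      mul_zero, add_zero]
  have h2 : opTrace (ρ.op * N * L) = opTrace (L * ρ.op * (b : HS H).op) := by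
    rw [hN, centered, mul_add, mul_smul_comm, mul_one, add_mul, smul_mul_assoc,
      opTrace_add ((ht.mul_right _).mul_right _) ((ht.mul_right L).smul _), opTrace_smul, hL0,
      mul_zero, add_zero, opTrace_mul_comm (ht.mul_right _), mul_assoc]
  change symCov ρ.op A B = ((⟪(b : HS H), χ⟫_ℝ : ℝ) : ℂ)
  rw [hreal, symCov, cov_eq_opTrace_centered hρ.isSelfAdjoint hA hA' hB hB',
    cov_eq_opTrace_centered hρ.isSelfAdjoint hB hB' hA hA', ← hL, ← hN, ha.star_eq, hb.star_eq,
    h1, h2, HS.inner_eq_opTrace, hb.star_eq, hχdef, HS.op_ofTraceClass, ← opTrace_mul_comm htK,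
    KS_apply, smul_mul_assoc, opTrace_smul, add_mul,
    opTrace_add ((ht.mul_right L).mul_right _) ((ht.mul_left L).mul_right _)]
  ring

end QEst

end

theorem mainTheorem8 {H : Type*} [NormedAddCommGroup H] [InnerProductSpace ℂ H] [CompleteSpace H]
    [TopologicalSpace.SeparableSpace H] {Ω : Type*} [MeasurableSpace Ω]
    (ρ₀ : QEst.DensityOperator H) (θ : QEst.paramSet ρ₀) (M : QEst.POVM Ω H)
    (A B : H →ₗ.[ℂ] H)
    (hA : A ∈ QEst.finiteExp (QEst.stateAt ρ₀ θ).op)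
    (hB : B ∈ QEst.finiteExp (QEst.stateAt ρ₀ θ).op)
    (hAB : QEst.pmul A.adjoint B ∈ QEst.finiteExp (QEst.stateAt ρ₀ θ).op)
    (a b : QEst.XiC H)
    (ha : QEst.IsGradient ρ₀ θ A a) (hb : QEst.IsGradient ρ₀ θ B b)
    (haM : (a : QEst.HS H) ∈ M.fisherKerPerp (QEst.stateAt ρ₀ θ))
    (hbM : (b : QEst.HS H) ∈ M.fisherKerPerp (QEst.stateAt ρ₀ θ)) :
    (∃ h : a ∈ (QEst.moorePenrose (QEst.fisherR (QEst.stateAt ρ₀ θ))).domain,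
      QEst.cov (QEst.stateAt ρ₀ θ).op A B =
        ⟪b, QEst.moorePenrose (QEst.fisherR (QEst.stateAt ρ₀ θ)) ⟨a, h⟩⟫_ℂ) ∧
    (IsSelfAdjoint A → IsSelfAdjoint B →
      ∃ a' b' : QEst.XiR H, (a' : QEst.HS H) = a ∧ (b' : QEst.HS H) = b ∧
        ∃ h : a' ∈ (QEst.moorePenrose (QEst.fisherS (QEst.stateAt ρ₀ θ))).domain,
          QEst.symCov (QEst.stateAt ρ₀ θ).op A B =
            ((⟪b', QEst.moorePenrose (QEst.fisherS (QEst.stateAt ρ₀ θ)) ⟨a', h⟩⟫_ℝ : ℝ) : ℂ)) := by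
  have hρ : QEst.IsStrictlyPos (QEst.stateAt ρ₀ θ).op := θ.2.2
  obtain ⟨c, hc⟩ := ha.exists_eq hA
  obtain ⟨d, hd⟩ := hb.exists_eq hB
  refine ⟨QEst.cov_eq_inner_moorePenrose hρ hA.1 hc hB.1 hd, fun hAs hBs => ?_⟩
  -- The bounded extension a* + c inherits self-adjointness from A, which makes a self-adjoint and
  -- puts it in Ξ; likewise for b.
  have ha' := QEst.mem_XiR_of_isSelfAdjoint a.2
    (QEst.isSelfAdjoint_of_isSelfAdjoint_star_add a.2 (QEst.isSelfAdjoint_of_bounded hAs hc))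
  have hb' := QEst.mem_XiR_of_isSelfAdjoint b.2
    (QEst.isSelfAdjoint_of_isSelfAdjoint_star_add b.2 (QEst.isSelfAdjoint_of_bounded hBs hd))
  exact ⟨⟨a, ha'⟩, ⟨b, hb'⟩, rfl, rfl,
    QEst.symCov_eq_inner_moorePenrose (a := ⟨a, ha'⟩) (b := ⟨b, hb'⟩) hρ hA.1 hc hB.1 hd⟩
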